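/- **Setting.** Identify $\mathbb R^2$ with $\mathbb C$. Let $A_0,\dots,A_\ell$ be the successive vertices of a polygon and let $A_q$ be one of them, with $\operatorname{Im}\frac{A_q-A_0}{A_\ell-A_0}>0$ (in particular $A_0\neq A_\ell$). Let $\Pi_0$ be the interior of the triangle $A_0A_\ell A_q$ and $\Pi_1=\overline{\Pi_0}$. For $1\le j\le \ell$ let $S_j$ be the orientation preserving map $S_j(z)=\frac{A_j-A_{j-1}}{A_\ell-A_0}(z-A_0)+A_{j-1}$, so that $S_j(A_0)=A_{j-1}$ and $S_j(A_\ell)=A_j$. The polygon is called a *basic figure* if * $A_1,A_{\ell-1}\in\overline{A_0A_\ell}$ and $A_{\ell-1}\in\overline{A_1A_\ell}$; * every vertex lies in $\{A_q\}\cup\overline{A_0A_\ell}\cup\Pi_0$; * every $S_j$ is a contractive similitude (its ratio lies in $(0,1)$), the sets $S_j(\Pi_0)$ are pairwise disjoint, and $S_j(A_q)\in\Pi_1$ for all $j$; * $S_j(\Pi_1)\cap(\overline{A_qA_0}\cup\overline{A_qA_\ell})=\emptyset$ for $j\notin\{1,\ell,q,q+1\}$. With arguments taken in $[0,2\pi)$,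 put $\theta_p=\arg\frac{S_p(A_q)-A_p}{S_{p+1}(A_q)-A_p}$ for $1\le p\le \ell-1$, $\theta_{\min}=\min_p\theta_p$, $\eta_1=\arg\frac{S_q(A_q)-A_q}{A_0-A_q}$, $\eta_2=\arg\frac{A_\ell-A_q}{S_{q+1}(A_q)-A_q}$. The *characteristic angle* of the basic figure is $\theta_{\min}+\min(\eta_1,\eta_2)$. A *regular self-similar arc* is an arc (a homeomorphic image of $[0,1]$) $\Lambda\subset\mathbb C$ which is the self-similar set of $S_1,\dots,S_\ell$ (the nonempty compact set with $\Lambda=\bigcup_{j=1}^\ell S_j(\Lambda)$) for some basic figure with positive characteristic angle. For points $x,y$ of an arc $\Lambda$, let $\Lambda(x,y)$ be the subarc between $x$ and $y$ and $|\Lambda(x,y)|$ its diameter. For $t\ge1$, $\Lambda$ is a *$t$-quasi-arc* if there is a constant $C>0$ with $|\Lambda(x,y)|^t\le C|x-y|$ for all $x,y\in\Lambda$. A function $f:E\to\mathbb R$ on a connected set $E\subset\mathbb R^2$ is a *Whitney function on $E$* if it is not constant and it is the restriction to $E$ of a $C^1$ function $F:\mathbb R^2\to\mathbb R$ with $\nabla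 F=0$ at every point of $E$. **Proposition.** Let $\Lambda$ be a regular self-similar arc, let $s=\dim_H\Lambda$, let $z_0$ be the initial point of $\Lambda$ (the end point of $\Lambda$ that lies in $S_1(\Lambda)$), and let $f:\Lambda\to\mathbb R$, $f(x)=H^s(\Lambda(z_0,x))$, be the $s$-dimensional Hausdorff measure function. 1. If $f$ is a Whitney function on $\Lambda$, then $\Lambda$ is an $s$-quasi-arc. 2. If $\Lambda$ is a $t$-quasi-arc for some $t$ with $1\le t<s$, then $f$ is a Whitney function on $\Lambda$. -/

import Mathlib

open Set MeasureTheory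
open scoped MeasureTheory unitInterval

noncomputable section

/-- The argument of a complex number, normalized to lie in `[0, 2π)`. -/
def argTwoPi (w : ℂ) : ℝ := toIcoMod Real.two_pi_pos 0 (Complex.arg w)

/-- The polygonal data `A 0, …, A ℓ` underlying a basic figure, with the index `q` of its apex.
Only the values `A j` with `j ≤ ℓ` play a role. -/
structure PolygonData where
  ℓ : ℕ
  A : ℕ → ℂ
  q : ℕ

namespace PolygonData

variable (Ω : PolygonData)

/-- The orientation preserving similitude `S j` (for `1 ≤ j ≤ ℓ`) of the complex plane
with `S j (A 0) = A (j - 1)` and `S j (A ℓ) = A j`. -/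
def S (j : ℕ) (z : ℂ) : ℂ :=
  (Ω.A j - Ω.A (j - 1)) / (Ω.A Ω.ℓ - Ω.A 0) * (z - Ω.A 0) + Ω.A (j - 1)

/-- The ratio of the similitude `S j`. -/
def ratio (j : ℕ) : ℝ := ‖(Ω.A j - Ω.A (j - 1)) / (Ω.A Ω.ℓ - Ω.A 0)‖

/-- The interior `Π₀` of the triangle with vertices `A 0`, `A ℓ`, `A q`. -/
def openTriangle : Set ℂ := interior (convexHull ℝ {Ω.A 0, Ω.A Ω.ℓ, Ω.A Ω.q})

/-- `Π₁`, the closure of `Π₀`. -/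
def closedTriangle : Set ℂ := closure Ω.openTriangle

/-- The conditions for a polygon `A 0, …, A ℓ` to be a basic figure with apex `A q`.
The condition `apex_pos` says that `A 0`, `A ℓ`, `A q` are not collinear
and that the triangle lies on the left of the directed base from `A 0` to `A ℓ`. -/
structure IsBasicFigure : Prop where
  q_le : Ω.q ≤ Ω.ℓ
  apex_pos : 0 < ((Ω.A Ω.q - Ω.A 0) / (Ω.A Ω.ℓ - Ω.A 0)).im
  first_mem : Ω.A 1 ∈ segment ℝ (Ω.A 0) (Ω.A Ω.ℓ)
  last_mem : Ω.A (Ω.ℓ - 1) ∈ segment ℝ (Ω.A 0) (Ω.A Ω.ℓ)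
  last_mem' : Ω.A (Ω.ℓ - 1) ∈ segment ℝ (Ω.A 1) (Ω.A Ω.ℓ)
  vertex_mem : ∀ j ≤ Ω.ℓ,
    Ω.A j ∈ {Ω.A Ω.q} ∪ segment ℝ (Ω.A 0) (Ω.A Ω.ℓ) ∪ Ω.openTriangle
  ratio_pos : ∀ j ∈ Icc 1 Ω.ℓ, 0 < Ω.ratio j
  ratio_lt_one : ∀ j ∈ Icc 1 Ω.ℓ, Ω.ratio j < 1
  disjoint : ∀ i ∈ Icc 1 Ω.ℓ, ∀ j ∈ Icc 1 Ω.ℓ, i ≠ j →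
    Disjoint (Ω.S i '' Ω.openTriangle) (Ω.S j '' Ω.openTriangle)
  apex_mem : ∀ j ∈ Icc 1 Ω.ℓ, Ω.S j (Ω.A Ω.q) ∈ Ω.closedTriangle
  sides : ∀ j ∈ Icc 1 Ω.ℓ, j ≠ 1 → j ≠ Ω.ℓ → j ≠ Ω.q → j ≠ Ω.q + 1 →
    (Ω.S j '' Ω.closedTriangle) ∩
      (segment ℝ (Ω.A Ω.q) (Ω.A 0) ∪ segment ℝ (Ω.A Ω.q) (Ω.A Ω.ℓ)) = ∅

/-- The corner angle `θ_p` at the vertex `A p`, for `1 ≤ p ≤ ℓ - 1`. -/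
def cornerAngle (p : ℕ) : ℝ :=
  argTwoPi ((Ω.S p (Ω.A Ω.q) - Ω.A p) / (Ω.S (p + 1) (Ω.A Ω.q) - Ω.A p))

/-- `θ_min`, the least of the corner angles `θ_1, …, θ_{ℓ-1}`
(for a basic figure the index set is finite and nonempty, so the infimum is a minimum). -/
def minCornerAngle : ℝ := sInf (Ω.cornerAngle '' Icc 1 (Ω.ℓ - 1))

/-- The angle `η₁` at the apex. -/
def eta₁ : ℝ :=
  argTwoPi ((Ω.S Ω.q (Ω.A Ω.q) - Ω.A Ω.q) / (Ω.A 0 - Ω.A Ω.q))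

/-- The angle `η₂` at the apex. -/
def eta₂ : ℝ :=
  argTwoPi ((Ω.A Ω.ℓ - Ω.A Ω.q) / (Ω.S (Ω.q + 1) (Ω.A Ω.q) - Ω.A Ω.q))

/-- The characteristic angle `ξ = θ_min + min (η₁, η₂)`. -/
def characteristicAngle : ℝ := Ω.minCornerAngle + min Ω.eta₁ Ω.eta₂

/-- `Λ` is the self-similar set of `S 1, …, S ℓ`: the nonempty compact set which is the union
of its images under these maps. -/
structure IsSelfSimilarSet (Λ : Set ℂ) : Prop where
  nonempty : Λ.Nonempty
  isCompact : IsCompact Λ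
  eq_iUnion : Λ = ⋃ j ∈ Icc 1 Ω.ℓ, Ω.S j '' Λ

/-- `Λ` is the regular self-similar arc generated by `Ω`: `Ω` is a basic figure with positive
characteristic angle, and the self-similar set `Λ` of `Ω` is an arc. -/
structure IsRegularSelfSimilarArc (Λ : Set ℂ) : Prop where
  isBasicFigure : Ω.IsBasicFigure
  isSelfSimilarSet : Ω.IsSelfSimilarSet Λ
  isArc : Nonempty (I ≃ₜ Λ)
  characteristicAngle_pos : 0 < Ω.characteristicAngle

end PolygonData

/-- The subarc `Λ(x, y)` between `x` and `y` of an arc `Λ` parametrized by `h : [0, 1] ≃ₜ Λ`. -/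
def subarc {Λ : Set ℂ} (h : I ≃ₜ Λ) (x y : Λ) : Set ℂ :=
  (fun u : I => (h u : ℂ)) '' uIcc (h.symm x) (h.symm y)

/-- `Λ` is a `t`-quasi-arc, `t ≥ 1`: an arc with `|Λ(x, y)| ^ t ≤ C |x - y|` for all
`x, y ∈ Λ`, where `|·|` is the diameter. The subarcs do not depend on the parametrization `h`. -/
def IsQuasiArc (t : ℝ) (Λ : Set ℂ) : Prop :=
  1 ≤ t ∧ ∃ h : I ≃ₜ Λ, ∃ C : ℝ, 0 < C ∧
    ∀ x y : Λ, Metric.diam (subarc h x y) ^ t ≤ C * dist x y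

/-- `f` is a Whitney function on the connected set `E`: a nonconstant restriction to `E`
of a `C¹` function on the plane whose derivative vanishes on `E`. -/
def IsWhitneyFunctionOn (E : Set ℂ) (f : E → ℝ) : Prop :=
  IsConnected E ∧
  (∃ F : ℂ → ℝ, ContDiff ℝ 1 F ∧ (∀ x ∈ E, fderiv ℝ F x = 0) ∧ ∀ x : E, F x = f x) ∧
  ∃ x y : E, f x ≠ f y

/-- The `s`-dimensional Hausdorff measure function `x ↦ H^s([h 0, x])` on an arc with
initial point `h 0`. -/
def hausdorffFunction {Λ : Set ℂ} (h : I ≃ₜ Λ) (s : ℝ) (x : Λ) : ℝ :=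
  (μH[s] (subarc h (h 0) x)).toReal

end

/-!
The triangle of a basic figure is an open set for its similitudes, so finitely many pieces of `Λ`
of size comparable to `diam U` cover `U ⊆ Λ`, with a number that does not depend on `U`. This gives
`0 < H^s(Λ) < ∞` and `H^s(U) ≤ B (diam U)^s`. Conversely every subarc contains a piece of `Λ` of
comparable diameter, so that `c |Λ(x, y)|^s ≤ H^s(Λ(x, y)) ≤ B |Λ(x, y)|^s`, where
`H^s(Λ(x, y)) = |f x - f y|`. A `C¹` extension of `f` is Lipschitz on `Λ`, and the lower bound turns
this into the `s`-quasi-arc inequality. If `Λ` is a `t`-quasi-arc with `t < s`, the upper bound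
makes `f` Hölder continuous on `Λ` with exponent `s / t > 1`, and such a function extends to a `C¹`
function whose derivative vanishes on `Λ`: a telescoping sum of mollifications at dyadic scales.
-/

open Filter Topology ENNReal NNReal Metric

section Words

variable {ι X : Type*}

/-- The word formed by the first `n` letters of the sequence `ω`. -/
def initialWord (ω : ℕ → ι) (n : ℕ) : List ι := List.ofFn fun i : Fin n => ω i

lemma length_initialWord (ω : ℕ → ι) (n : ℕ) : (initialWord ω n).length = n :=
  List.length_ofFn

lemma initialWord_succ (ω : ℕ → ι) (n : ℕ) :
    initialWord ω (n + 1) = initialWord ω n ++ [ω n] := by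
  rw [initialWord, List.ofFn_succ_last]
  rfl

lemma initialWord_eq_iff {ω ω' : ℕ → ι} {n : ℕ} :
    initialWord ω n = initialWord ω' n ↔ ∀ i < n, ω i = ω' i := by
  simp only [initialWord, List.ofFn_inj, funext_iff, Fin.forall_iff]

lemma eq_initialWord_of_prefix {ω : ℕ → ι} {n : ℕ} {v : List ι} (h : v <+: initialWord ω n) :
    v = initialWord ω v.length := by
  refine List.ext_getElem (length_initialWord _ _).symm fun i hi _ => ?_
  simp [h.getElem hi, initialWord]

variable [PseudoEMetricSpace X] {f : ι → X ≃ᵈ X}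

/-- The composition `f i₁ ∘ ⋯ ∘ f iₙ` of the maps of an iterated function system of dilations
along the word `[i₁, …, iₙ]`. -/
def wordMap (f : ι → X ≃ᵈ X) (w : List ι) : X ≃ᵈ X := (w.map f).prod

@[simp] lemma wordMap_nil : wordMap f [] = 1 := rfl

lemma wordMap_cons (i : ι) (w : List ι) : wordMap f (i :: w) = f i * wordMap f w := by
  simp [wordMap]

lemma wordMap_append (u v : List ι) : wordMap f (u ++ v) = wordMap f u * wordMap f v := by
  simp [wordMap]

lemma image_wordMap_append (u v : List ι) (K : Set X) :
    wordMap f (u ++ v) '' K = wordMap f u '' (wordMap f v '' K) := by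
  rw [wordMap_append, DilationEquiv.coe_mul, image_comp]

lemma ratio_wordMap (w : List ι) :
    Dilation.ratio (wordMap f w) = (w.map fun i => Dilation.ratio (f i)).prod :=
  (map_list_prod DilationEquiv.ratioHom (w.map f)).trans (by rw [List.map_map]; rfl)

lemma ratio_wordMap_append (u v : List ι) : Dilation.ratio (wordMap f (u ++ v)) =
    Dilation.ratio (wordMap f u) * Dilation.ratio (wordMap f v) := by
  simp [ratio_wordMap]

lemma ratio_wordMap_le_pow {r : ℝ≥0} (hr : ∀ i, Dilation.ratio (f i) ≤ r) (w : List ι) :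
    Dilation.ratio (wordMap f w) ≤ r ^ w.length := by
  rw [ratio_wordMap, ← List.length_map (f := fun i => Dilation.ratio (f i)) (as := w)]
  exact List.prod_le_pow_card _ _ (by simpa using fun i _ => hr i)

lemma exists_ratio_le_lt_one [Finite ι] (hf : ∀ i, Dilation.ratio (f i) < 1) :
    ∃ r < 1, ∀ i, Dilation.ratio (f i) ≤ r := by
  cases isEmpty_or_nonempty ι
  · exact ⟨0, one_pos, isEmptyElim⟩
  · obtain ⟨i, hi⟩ := Finite.exists_max fun i => Dilation.ratio (f i)
    exact ⟨_, hf i, hi⟩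

lemma exists_pos_le_ratio [Finite ι] (f : ι → X ≃ᵈ X) :
    ∃ m : ℝ≥0, 0 < m ∧ ∀ i, m ≤ Dilation.ratio (f i) := by
  cases isEmpty_or_nonempty ι
  · exact ⟨1, one_pos, isEmptyElim⟩
  · obtain ⟨i, hi⟩ := Finite.exists_min fun i => Dilation.ratio (f i)
    exact ⟨_, Dilation.ratio_pos _, hi⟩

lemma tendsto_ratio_initialWord [Finite ι] (hf : ∀ i, Dilation.ratio (f i) < 1) (ω : ℕ → ι) :
    Tendsto (fun n => Dilation.ratio (wordMap f (initialWord ω n))) atTop (𝓝 0) := by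
  obtain ⟨r, hr, hfr⟩ := exists_ratio_le_lt_one hf
  refine tendsto_of_tendsto_of_tendsto_of_le_of_le tendsto_const_nhds
    (tendsto_pow_atTop_nhds_zero_of_lt_one zero_le hr) (fun _ => zero_le) fun n => ?_
  simpa only [length_initialWord] using ratio_wordMap_le_pow hfr (initialWord ω n)

lemma image_wordMap_subset {V : Set X} (hV : ∀ i, f i '' V ⊆ V) (w : List ι) :
    wordMap f w '' V ⊆ V := by
  induction w with
  | nil => simp
  | cons i w ih =>
    rw [wordMap_cons, DilationEquiv.coe_mul, image_comp]
    exact (image_mono ih).trans (hV i)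

/-- The open set condition for an iterated function system: `V` is a nonempty open set which
contains its images under the maps `f i`, and these images are pairwise disjoint. -/
structure OpenSetCondition (f : ι → X ≃ᵈ X) (V : Set X) : Prop where
  isOpen : IsOpen V
  nonempty : V.Nonempty
  image_subset : ∀ i, f i '' V ⊆ V
  disjoint : Pairwise fun i j => Disjoint (f i '' V) (f j '' V)

lemma OpenSetCondition.disjoint_image_wordMap {V : Set X} (hV : OpenSetCondition f V) :
    ∀ {w v : List ι}, ¬ w <+: v → ¬ v <+: w → Disjoint (wordMap f w '' V) (wordMap f v '' V)
  | [], _, h, _ => (h List.nil_prefix).elim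
  | _ :: _, [], _, h => (h List.nil_prefix).elim
  | i :: w, j :: v, h, h' => by
    simp only [wordMap_cons, DilationEquiv.coe_mul, image_comp]
    rcases eq_or_ne i j with rfl | hij
    · rw [List.prefix_cons_inj] at h h'
      exact (disjoint_image_iff (f i).injective).2 (hV.disjoint_image_wordMap h h')
    · exact (hV.disjoint hij).mono (image_mono (image_wordMap_subset hV.image_subset w))
        (image_mono (image_wordMap_subset hV.image_subset v))

/-- The word `w` is minimal, for the prefix order, among the words whose maps have ratio at most
`d`. These words enumerate the pieces of a self-similar set of size comparable to `d`. -/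
def IsStopping (f : ι → X ≃ᵈ X) (d : ℝ≥0) (w : List ι) : Prop :=
  Dilation.ratio (wordMap f w) ≤ d ∧
    ∀ v, v <+: w → v ≠ w → d < Dilation.ratio (wordMap f v)

lemma IsStopping.eq_of_prefix {d : ℝ≥0} {w w' : List ι} (h : IsStopping f d w)
    (h' : IsStopping f d w') (hp : w <+: w') : w = w' := by
  by_contra hne
  exact (h'.2 w hp hne).not_ge h.1

lemma IsStopping.mul_le_ratio {d m : ℝ≥0} (hm : ∀ i, m ≤ Dilation.ratio (f i)) {w : List ι}
    (h : IsStopping f d w) (hw : w ≠ []) : m * d ≤ Dilation.ratio (wordMap f w) := by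
  obtain ⟨v, i, rfl⟩ := (List.eq_nil_or_concat w).resolve_left hw
  rw [List.concat_eq_append] at h ⊢
  have hd := h.2 v (by simp) (by simp)
  rw [ratio_wordMap_append, ratio_wordMap [i], List.map_singleton, List.prod_singleton, mul_comm]
  exact mul_le_mul' hd.le (hm i)

lemma exists_isStopping_initialWord [Finite ι] (hf : ∀ i, Dilation.ratio (f i) < 1) (ω : ℕ → ι)
    {d : ℝ≥0} (hd : 0 < d) : ∃ n, IsStopping f d (initialWord ω n) := by
  classical
  have hex : ∃ n, Dilation.ratio (wordMap f (initialWord ω n)) ≤ d :=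
    ((tendsto_ratio_initialWord hf ω).eventually_le_const hd).exists
  refine ⟨Nat.find hex, Nat.find_spec hex, fun v hv hne => ?_⟩
  have hlen : v.length < Nat.find hex := by
    refine lt_of_le_of_ne (hv.length_le.trans_eq (length_initialWord _ _)) fun h => hne ?_
    rw [← h, ← eq_initialWord_of_prefix hv]
  rw [eq_initialWord_of_prefix hv]
  exact not_le.1 (Nat.find_min hex hlen)

/-- `ω` is an address of the point `x` of the invariant set `K`: the pieces of `K` along the
initial words of `ω` all contain `x`. -/
def IsAddress (f : ι → X ≃ᵈ X) (K : Set X) (ω : ℕ → ι) (x : X) : Prop :=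
  ∀ n, x ∈ wordMap f (initialWord ω n) '' K

lemma exists_isAddress {K : Set X} (hK : K = ⋃ i, f i '' K) {x : X} (hx : x ∈ K) :
    ∃ ω, IsAddress f K ω x := by
  have hpre : ∀ y : K, ∃ i, ∃ z : K, f i z = y := by
    rintro ⟨y, hy⟩
    rw [hK] at hy
    obtain ⟨i, z, hz, rfl⟩ := mem_iUnion.1 hy
    exact ⟨i, ⟨z, hz⟩, rfl⟩
  choose i g hg using hpre
  refine ⟨fun n => i (g^[n] ⟨x, hx⟩), fun n => ⟨g^[n] ⟨x, hx⟩, Subtype.coe_prop _, ?_⟩⟩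
  induction n with
  | zero => rfl
  | succ n ih =>
    rw [initialWord_succ, wordMap_append, Function.iterate_succ_apply', DilationEquiv.coe_mul]
    simpa [wordMap_cons, hg] using ih

end Words

section Packing

lemma encard_le_of_forall_finset_card_le {α : Type*} {T : Set α} {N : ℕ}
    (h : ∀ W : Finset α, ↑W ⊆ T → W.card ≤ N) : T.encard ≤ N := by
  by_contra! hlt
  obtain ⟨S, hST, hS⟩ := exists_subset_encard_eq (Order.add_one_le_of_lt hlt)
  have hfin : S.Finite := finite_of_encard_eq_coe (k := N + 1) (by simpa using hS)
  have hle := h hfin.toFinset (by simpa using hST)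
  rw [hfin.encard_eq_coe_toFinset_card] at hS
  norm_cast at hS
  lia

variable {E : Type*} [NormedAddCommGroup E] [NormedSpace ℝ E] [FiniteDimensional ℝ E]

lemma card_le_of_pairwiseDisjoint_ball {α : Type*} {W : Finset α} {c : α → E} {u : E} {r R : ℝ}
    (hr : 0 < r) (hR : 0 < R) (hdisj : (W : Set α).PairwiseDisjoint fun w => ball (c w) r)
    (hsub : ∀ w ∈ W, ball (c w) r ⊆ ball u R) :
    (W.card : ℝ) ≤ (R / r) ^ Module.finrank ℝ E := by
  borelize E
  let μ : Measure E := Measure.addHaar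
  have hvol : ∑ w ∈ W, μ (ball (c w) r) ≤ μ (ball u R) := by
    rw [← measure_biUnion_finset hdisj fun _ _ => measurableSet_ball]
    exact measure_mono (iUnion₂_subset hsub)
  simp only [Measure.addHaar_ball_of_pos μ _ hr, Measure.addHaar_ball_of_pos μ _ hR,
    Finset.sum_const, nsmul_eq_mul] at hvol
  rw [← mul_assoc, ENNReal.mul_le_mul_iff_left (measure_ball_pos μ 0 one_pos).ne'
    measure_ball_lt_top.ne, ← ENNReal.ofReal_natCast, ← ENNReal.ofReal_mul (by positivity),
    ENNReal.ofReal_le_ofReal_iff (by positivity)] at hvol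
  rwa [div_pow, le_div_iff₀ (by positivity)]

variable {ι : Type*} {f : ι → E ≃ᵈ E} {V K : Set E}

lemma OpenSetCondition.card_le_of_isStopping (hV : OpenSetCondition f V) {c : E} {ρ R : ℝ}
    (hρ : 0 < ρ) (hR : 0 < R) (hc : ball c ρ ⊆ V) (hK : K ⊆ ball c R) {m d : ℝ≥0} (hm : 0 < m)
    (hfm : ∀ i, m ≤ Dilation.ratio (f i)) (hd : 0 < d) {U : Set E} (hU : ediam U ≤ d)
    {W : Finset (List ι)} (hW : ∀ w ∈ W, IsStopping f d w)
    (hKU : ∀ w ∈ W, (wordMap f w '' K ∩ U).Nonempty) (hnil : [] ∉ W) :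
    (W.card : ℝ) ≤ ((1 + R + ρ) / (m * ρ)) ^ Module.finrank ℝ E := by
  rcases W.eq_empty_or_nonempty with rfl | ⟨w₀, hw₀⟩
  · simpa using by positivity
  obtain ⟨u, -, hu⟩ := hKU w₀ hw₀
  have himage : ∀ w ∈ W, ball (wordMap f w c) (d * (m * ρ)) ⊆ wordMap f w '' ball c ρ := by
    intro w hw z hz
    obtain ⟨x, rfl⟩ := (wordMap f w).surjective z
    have hle : (m * d : ℝ) ≤ Dilation.ratio (wordMap f w) :=
      mod_cast (hW w hw).mul_le_ratio hfm (ne_of_mem_of_not_mem hw hnil)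
    rw [mem_ball, Dilation.dist_eq, ← mul_assoc, mul_comm (d : ℝ)] at hz
    exact ⟨x, lt_of_mul_lt_mul_left (hz.trans_le (by gcongr)) (NNReal.coe_nonneg _), rfl⟩
  have hdisj : (W : Set (List ι)).PairwiseDisjoint
      fun w => ball (wordMap f w c) (d * (m * ρ)) := fun w hw w' hw' hne =>
    (hV.disjoint_image_wordMap (fun h => hne ((hW w hw).eq_of_prefix (hW w' hw') h))
      fun h => hne.symm ((hW w' hw').eq_of_prefix (hW w hw) h)).mono
      ((himage w hw).trans (image_mono hc)) ((himage w' hw').trans (image_mono hc))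
  have hsub : ∀ w ∈ W, ball (wordMap f w c) (d * (m * ρ)) ⊆ ball u (d * (1 + R + ρ)) := by
    intro w hw z hz
    obtain ⟨x, hx, rfl⟩ := himage w hw hz
    obtain ⟨_, ⟨y, hy, rfl⟩, hyU⟩ := hKU w hw
    have hyu : dist (wordMap f w y) u ≤ d :=
      NNReal.coe_le_coe.2 (edist_le_coe.1 ((edist_le_ediam_of_mem hyU hu).trans hU))
    have hxy : dist (wordMap f w x) (wordMap f w y) < d * (ρ + R) := by
      rw [Dilation.dist_eq]
      have hlt : dist x y < ρ + R :=
        (dist_triangle_right x y c).trans_lt (add_lt_add hx (hK hy))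
      exact mul_lt_mul' (mod_cast (hW w hw).1) hlt dist_nonneg hd
    calc dist (wordMap f w x) u ≤ dist (wordMap f w x) (wordMap f w y) + dist (wordMap f w y) u :=
          dist_triangle _ _ _
      _ < d * (ρ + R) + d := add_lt_add_of_lt_of_le hxy hyu
      _ = d * (1 + R + ρ) := by ring
  simpa [mul_div_mul_left _ _ (NNReal.coe_pos.2 hd).ne'] using
    card_le_of_pairwiseDisjoint_ball (by positivity) (by positivity) hdisj hsub

theorem OpenSetCondition.exists_finset_isStopping [Finite ι] (hV : OpenSetCondition f V)
    (hK : Bornology.IsBounded K) :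
    ∃ N : ℕ, ∀ d : ℝ≥0, 0 < d → ∀ U : Set E, ediam U ≤ d →
      ∃ W : Finset (List ι), W.card ≤ N ∧ (∀ w ∈ W, IsStopping f d w) ∧
        ∀ w, IsStopping f d w → (wordMap f w '' K ∩ U).Nonempty → w ∈ W := by
  obtain ⟨c, hcV⟩ := hV.nonempty
  obtain ⟨ρ, hρ, hc⟩ := Metric.isOpen_iff.1 hV.isOpen c hcV
  obtain ⟨R, hR, hKR⟩ := hK.subset_ball_lt 0 c
  obtain ⟨m, hm, hfm⟩ := exists_pos_le_ratio f
  refine ⟨max 1 ⌊((1 + R + ρ) / (m * ρ)) ^ Module.finrank ℝ E⌋₊, fun d hd U hU => ?_⟩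
  set T := {w | IsStopping f d w ∧ (wordMap f w '' K ∩ U).Nonempty}
  have hcard : T.encard ≤ (max 1 ⌊((1 + R + ρ) / (m * ρ)) ^ Module.finrank ℝ E⌋₊ : ℕ) := by
    refine encard_le_of_forall_finset_card_le fun W hW => ?_
    by_cases hnil : [] ∈ W
    · refine le_max_of_le_left (Finset.card_le_one_iff_subset_singleton.2 ⟨[], fun w hw => ?_⟩)
      rw [Finset.mem_singleton, (hW hnil).1.eq_of_prefix (hW hw).1 List.nil_prefix]
    · exact le_max_of_le_right (Nat.le_floor (hV.card_le_of_isStopping hρ hR hc hKR hm hfm hd hU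
        (fun w hw => (hW hw).1) (fun w hw => (hW hw).2) hnil))
  obtain ⟨hfin, hncard⟩ := encard_le_coe_iff_finite_ncard_le.1 hcard
  refine ⟨hfin.toFinset, ?_, fun w hw => (hfin.mem_toFinset.1 hw).1,
    fun w hw hwU => hfin.mem_toFinset.2 ⟨hw, hwU⟩⟩
  rwa [← ncard_eq_toFinset_card _ hfin]

end Packing

section HausdorffMeasure

lemma le_mul_rpow_of_forall_nnreal {a C e : ℝ≥0∞} {s : ℝ} (hC : C ≠ ∞)
    (he : e ≠ ∞) (h : ∀ d : ℝ≥0, 0 < d → e ≤ d → a ≤ C * (d : ℝ≥0∞) ^ s) : a ≤ C * e ^ s := by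
  lift e to ℝ≥0 using he
  have hlim : Tendsto (fun d : ℝ≥0 => C * (d : ℝ≥0∞) ^ s) (𝓝[>] e) (𝓝 (C * (e : ℝ≥0∞) ^ s)) :=
    (ENNReal.Tendsto.const_mul (((ENNReal.continuous_rpow_const.comp
      ENNReal.continuous_coe).tendsto e)) (Or.inr hC)).mono_left nhdsWithin_le_nhds
  refine ge_of_tendsto hlim (eventually_mem_nhdsWithin.mono fun d hd => ?_)
  exact h d (pos_of_gt hd) (mod_cast (mem_Ioi.1 hd).le)

section EMetric

variable {X : Type*} [EMetricSpace X] [MeasurableSpace X] [BorelSpace X]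

lemma hausdorffMeasure_image_dilationEquiv {s : ℝ} (hs : 0 ≤ s) (e : X ≃ᵈ X) (K : Set X) :
    μH[s] (e '' K) = (Dilation.ratio e : ℝ≥0∞) ^ s * μH[s] K := by
  refine le_antisymm ((Dilation.lipschitz e).hausdorffMeasure_image_le hs K) ?_
  have hr : (Dilation.ratio e : ℝ≥0∞) ≠ 0 := by simpa using Dilation.ratio_ne_zero e
  calc (Dilation.ratio e : ℝ≥0∞) ^ s * μH[s] K
      ≤ (Dilation.ratio e : ℝ≥0∞) ^ s *
          (((Dilation.ratio e)⁻¹ : ℝ≥0) ^ s * μH[s] (e '' K)) := by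
        gcongr
        exact (Dilation.antilipschitz e).le_hausdorffMeasure_image hs K
    _ = μH[s] (e '' K) := by
        rw [← mul_assoc, ← ENNReal.mul_rpow_of_nonneg _ _ hs,
          ENNReal.coe_inv (Dilation.ratio_ne_zero e),
          ENNReal.mul_inv_cancel hr ENNReal.coe_ne_top, ENNReal.one_rpow, one_mul]

end EMetric

section Metric

variable {X ι : Type*} [MetricSpace X] {f : ι → X ≃ᵈ X} {K : Set X} {s : ℝ}

lemma sum_ediam_wordMap_rpow [Fintype ι] (hs : 0 ≤ s)
    (hsum : ∑ i, (Dilation.ratio (f i) : ℝ) ^ s = 1) (n : ℕ) :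
    ∑ p : Fin n → ι, ediam (wordMap f (List.ofFn p) '' K) ^ s = ediam K ^ s := by
  have hsum' : ∑ i, (Dilation.ratio (f i) : ℝ≥0∞) ^ s = 1 := by
    simp only [← ENNReal.coe_rpow_of_nonneg _ hs, ← ENNReal.ofNNReal_finsetSum]
    exact_mod_cast hsum
  have hterm : ∀ p : Fin n → ι, ediam (wordMap f (List.ofFn p) '' K) ^ s =
      (∏ j, (Dilation.ratio (f (p j)) : ℝ≥0∞) ^ s) * ediam K ^ s := fun p => by
    rw [Dilation.ediam_image, ENNReal.mul_rpow_of_nonneg _ _ hs, ratio_wordMap, List.map_ofFn,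
      List.prod_ofFn, ENNReal.ofNNReal_finsetProd, ENNReal.prod_rpow_of_nonneg hs]
    rfl
  rw [Finset.sum_congr rfl fun p _ => hterm p, ← Finset.sum_mul,
    ← Fintype.sum_pow (fun i => (Dilation.ratio (f i) : ℝ≥0∞) ^ s), hsum', one_pow, one_mul]

variable [MeasurableSpace X] [BorelSpace X]

lemma hausdorffMeasure_lt_top_of_sum_ratio_rpow [Fintype ι]
    (hf : ∀ i, Dilation.ratio (f i) < 1) (hK : K = ⋃ i, f i '' K) (hb : Bornology.IsBounded K)
    (hs : 0 ≤ s) (hsum : ∑ i, (Dilation.ratio (f i) : ℝ) ^ s = 1) : μH[s] K < ∞ := by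
  obtain ⟨r, hr, hfr⟩ := exists_ratio_le_lt_one hf
  have hdiam : ediam K ≠ ∞ := Metric.isBounded_iff_ediam_ne_top.1 hb
  have hlim : Tendsto (fun n : ℕ => (r : ℝ≥0∞) ^ n * ediam K) atTop (𝓝 0) := by
    simpa using ENNReal.Tendsto.mul_const
      (ENNReal.tendsto_pow_atTop_nhds_zero_of_lt_one (mod_cast hr)) (Or.inr hdiam)
  have hsmall : ∀ n (p : Fin n → ι), ediam (wordMap f (List.ofFn p) '' K) ≤
      (r : ℝ≥0∞) ^ n * ediam K := fun n p => by
    rw [Dilation.ediam_image]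
    gcongr
    simpa using ENNReal.coe_le_coe.2 (ratio_wordMap_le_pow hfr (List.ofFn p))
  have hcover : ∀ n, K ⊆ ⋃ p : Fin n → ι, wordMap f (List.ofFn p) '' K := fun n x hx => by
    obtain ⟨ω, hω⟩ := exists_isAddress hK hx
    exact mem_iUnion.2 ⟨fun i => ω i, hω n⟩
  calc μH[s] K ≤ liminf (fun n => ∑ p : Fin n → ι, ediam (wordMap f (List.ofFn p) '' K) ^ s)
        atTop := Measure.hausdorffMeasure_le_liminf_sum s K _ hlim
          (fun n p => wordMap f (List.ofFn p) '' K) (.of_forall hsmall) (.of_forall hcover)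
    _ = ediam K ^ s := by simp only [sum_ediam_wordMap_rpow hs hsum, liminf_const]
    _ < ∞ := ENNReal.rpow_lt_top_of_nonneg hs hdiam

end Metric

section NormedSpace

variable {E ι : Type*} [NormedAddCommGroup E] [NormedSpace ℝ E] [FiniteDimensional ℝ E]
  [Finite ι] {f : ι → E ≃ᵈ E} {V K : Set E} {s : ℝ}

/-- The common source of the upper regularity of the Hausdorff measure (where `π = id` and the
sets `B w` are the pieces of `K`) and of the mass distribution principle (where `π` is the coding
map and the sets `B w` are the cylinders). -/
theorem OpenSetCondition.exists_measure_inter_preimage_le (hV : OpenSetCondition f V)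
    (hf : ∀ i, Dilation.ratio (f i) < 1) (hK : Bornology.IsBounded K) (hs : 0 ≤ s) :
    ∃ N : ℕ, ∀ {α : Type*} [MeasurableSpace α] (μ : Measure α) (C : ℝ≥0) (A : Set α) (π : α → E)
      (B : List ι → Set α),
      (∀ w, μ (B w) ≤ C * (Dilation.ratio (wordMap f w) : ℝ≥0∞) ^ s) →
      (∀ a ∈ A, ∃ ω, IsAddress f K ω (π a) ∧ ∀ n, a ∈ B (initialWord ω n)) →
      ∀ U, ediam U ≠ ∞ → μ (A ∩ π ⁻¹' U) ≤ (N * C : ℝ≥0) * ediam U ^ s := by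
  obtain ⟨N, hN⟩ := hV.exists_finset_isStopping hK
  refine ⟨N, fun μ C A π B hB hA U hU => ?_⟩
  refine le_mul_rpow_of_forall_nnreal ENNReal.coe_ne_top hU fun d hd hUd => ?_
  obtain ⟨W, hWN, hWd, hW⟩ := hN d hd U hUd
  have hcover : A ∩ π ⁻¹' U ⊆ ⋃ w ∈ W, B w := by
    rintro a ⟨haA, haU⟩
    obtain ⟨ω, hω, ha⟩ := hA a haA
    obtain ⟨n, hn⟩ := exists_isStopping_initialWord hf ω hd
    exact mem_iUnion₂.2 ⟨_, hW _ hn ⟨π a, hω n, haU⟩, ha n⟩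
  calc μ (A ∩ π ⁻¹' U) ≤ ∑ w ∈ W, μ (B w) :=
        (measure_mono hcover).trans (measure_biUnion_finset_le _ _)
    _ ≤ ∑ _ ∈ W, C * (d : ℝ≥0∞) ^ s := by
        refine Finset.sum_le_sum fun w hw => (hB w).trans ?_
        gcongr
        exact (hWd w hw).1
    _ = W.card * (C * (d : ℝ≥0∞) ^ s) := by rw [Finset.sum_const, nsmul_eq_mul]
    _ ≤ N * (C * (d : ℝ≥0∞) ^ s) := by gcongr
    _ = (N * C : ℝ≥0) * (d : ℝ≥0∞) ^ s := by push_cast; ring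

theorem OpenSetCondition.exists_hausdorffMeasure_le [MeasurableSpace E] [BorelSpace E]
    (hV : OpenSetCondition f V) (hf : ∀ i, Dilation.ratio (f i) < 1) (hK : K = ⋃ i, f i '' K)
    (hb : Bornology.IsBounded K) (hs : 0 ≤ s) (hfin : μH[s] K ≠ ∞) :
    ∃ C : ℝ≥0, ∀ U ⊆ K, μH[s] U ≤ C * ediam U ^ s := by
  obtain ⟨N, hN⟩ := hV.exists_measure_inter_preimage_le hf hb hs
  refine ⟨N * (μH[s] K).toNNReal, fun U hUK => ?_⟩
  have hle := hN μH[s] (μH[s] K).toNNReal K id (fun w => wordMap f w '' K) (fun w => ?_)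
    (fun x hx => (exists_isAddress hK hx).imp fun ω hω => ⟨hω, hω⟩) U
    (Metric.isBounded_iff_ediam_ne_top.1 (hb.subset hUK))
  · rwa [preimage_id, inter_eq_right.2 hUK] at hle
  · rw [hausdorffMeasure_image_dilationEquiv hs, ENNReal.coe_toNNReal hfin, mul_comm]

end NormedSpace

end HausdorffMeasure

section Moran

section Coding

variable {X ι : Type*} [MetricSpace X] {f : ι → X ≃ᵈ X} {K : Set X}

lemma antitone_image_wordMap_initialWord (hK : ∀ i, f i '' K ⊆ K) (ω : ℕ → ι) :
    Antitone fun n => wordMap f (initialWord ω n) '' K :=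
  antitone_nat_of_succ_le fun n => by
    rw [initialWord_succ, image_wordMap_append]
    exact image_mono (image_wordMap_subset hK [ω n])

lemma exists_forall_isAddress (hK : ∀ i, f i '' K ⊆ K) (hc : IsCompact K) (hne : K.Nonempty) :
    ∃ π : (ℕ → ι) → X, ∀ ω, IsAddress f K ω (π ω) := by
  have hcompact : ∀ w, IsCompact (wordMap f w '' K) := fun w =>
    hc.image (Dilation.toContinuous (wordMap f w))
  have hex : ∀ ω : ℕ → ι, (⋂ n, wordMap f (initialWord ω n) '' K).Nonempty := fun ω =>
    IsCompact.nonempty_iInter_of_sequence_nonempty_isCompact_isClosed _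
      (fun n => antitone_image_wordMap_initialWord hK ω n.le_succ)
      (fun n => hne.image _) (hcompact _) (fun n => (hcompact _).isClosed)
  choose π hπ using hex
  exact ⟨π, fun ω => mem_iInter.1 (hπ ω)⟩

lemma continuous_of_isAddress [Finite ι] [TopologicalSpace ι] [DiscreteTopology ι]
    (hf : ∀ i, Dilation.ratio (f i) < 1) (hb : Bornology.IsBounded K) {π : (ℕ → ι) → X}
    (hπ : ∀ ω, IsAddress f K ω (π ω)) : Continuous π := by
  refine continuous_iff_continuousAt.2 fun ω => Metric.tendsto_nhds.2 fun ε hε => ?_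
  have hlim : Tendsto (fun n => Dilation.ratio (wordMap f (initialWord ω n)) * diam K) atTop
      (𝓝 0) := by
    simpa using (NNReal.tendsto_coe.2 (tendsto_ratio_initialWord hf ω)).mul_const (diam K)
  obtain ⟨n, hn⟩ := (hlim.eventually_lt_const hε).exists
  have hagree : ∀ᶠ ω' in 𝓝 ω, ∀ i < n, ω' i = ω i :=
    (eventually_all_finite (finite_Iio n)).2 fun i _ =>
      (continuous_apply i).continuousAt.eventually (mem_nhds_discrete.2 (mem_singleton (ω i)))
  filter_upwards [hagree] with ω' hω'
  have hmem := hπ ω' n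
  rw [initialWord_eq_iff.2 hω'] at hmem
  obtain ⟨x, hx, hx'⟩ := hπ ω n
  obtain ⟨y, hy, hy'⟩ := hmem
  rw [← hx', ← hy', Dilation.dist_eq]
  refine lt_of_le_of_lt ?_ hn
  gcongr
  exact Metric.dist_le_diam_of_mem hb hy hx

end Coding

lemma infinitePi_setOf_initialWord_eq {ι : Type*} [MeasurableSpace ι] [MeasurableSingletonClass ι]
    (p : Measure ι) [IsProbabilityMeasure p] (ω₀ : ℕ → ι) (n : ℕ) :
    Measure.infinitePi (fun _ : ℕ => p) {ω | initialWord ω n = initialWord ω₀ n} =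
      ∏ i : Fin n, p {ω₀ i} := by
  have hset : {ω | initialWord ω n = initialWord ω₀ n} =
      (↑(Finset.range n) : Set ℕ).pi fun i => {ω₀ i} := by
    ext ω
    simp [initialWord_eq_iff]
  rw [hset, Measure.infinitePi_pi _ fun _ _ => measurableSet_singleton _, Finset.prod_range]

lemma le_smul_hausdorffMeasure {X : Type*} [EMetricSpace X] [MeasurableSpace X] [BorelSpace X]
    {μ : Measure X} {C : ℝ≥0} {s : ℝ} (hC : C ≠ 0)
    (h : ∀ U, ediam U ≤ 1 → μ U ≤ C * ediam U ^ s) : μ ≤ C • μH[s] := by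
  have hle : C⁻¹ • μ ≤ μH[s] := Measure.le_hausdorffMeasure s _ 1 one_pos fun U hU => by
    rw [Measure.smul_apply, ENNReal.smul_def, smul_eq_mul, ENNReal.coe_inv hC]
    exact ENNReal.inv_mul_le_iff (by simpa using hC) ENNReal.coe_ne_top |>.2 (h U hU)
  intro U
  have hU := hle U
  rwa [Measure.smul_apply, ENNReal.smul_def, smul_eq_mul, ENNReal.coe_inv hC,
    ENNReal.inv_mul_le_iff (by simpa using hC) ENNReal.coe_ne_top] at hU

lemma exists_isProbabilityMeasure_initialWord_le {X ι : Type*} [PseudoEMetricSpace X] [Fintype ι]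
    [MeasurableSpace ι] [MeasurableSingletonClass ι] {f : ι → X ≃ᵈ X} {s : ℝ} (hs : 0 ≤ s)
    (hsum : ∑ i, (Dilation.ratio (f i) : ℝ) ^ s = 1) :
    ∃ P : Measure (ℕ → ι), IsProbabilityMeasure P ∧ ∀ w : List ι,
      P {ω | initialWord ω w.length = w} ≤ (Dilation.ratio (wordMap f w) : ℝ≥0∞) ^ s := by
  let p : PMF ι := PMF.ofFintype (fun i => (Dilation.ratio (f i) : ℝ≥0∞) ^ s) (by
    simp only [← ENNReal.coe_rpow_of_nonneg _ hs, ← ENNReal.ofNNReal_finsetSum]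
    exact_mod_cast hsum)
  refine ⟨Measure.infinitePi fun _ => p.toMeasure, inferInstance, fun w => ?_⟩
  rcases eq_empty_or_nonempty {ω : ℕ → ι | initialWord ω w.length = w} with h | ⟨ω₀, h₀⟩
  · simp [h]
  obtain ⟨n, rfl⟩ : ∃ n, w = initialWord ω₀ n := ⟨_, h₀.symm⟩
  rw [length_initialWord, infinitePi_setOf_initialWord_eq]
  simp only [PMF.toMeasure_apply_singleton _ _ (measurableSet_singleton _)]
  rw [ratio_wordMap, initialWord, List.map_ofFn, List.prod_ofFn, ENNReal.ofNNReal_finsetProd,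
    ← ENNReal.prod_rpow_of_nonneg hs]
  rfl

variable {E ι : Type*} [NormedAddCommGroup E] [NormedSpace ℝ E] [FiniteDimensional ℝ E]
  [MeasurableSpace E] [BorelSpace E] {f : ι → E ≃ᵈ E} {V K : Set E} {s : ℝ}

/-- The natural probability measure on the sequence space, in which a cylinder has the mass
`r ^ s` for the ratio `r` of its word, is a mass distribution on `K`. -/
theorem OpenSetCondition.hausdorffMeasure_ne_zero [Fintype ι] (hV : OpenSetCondition f V)
    (hf : ∀ i, Dilation.ratio (f i) < 1) (hK : ∀ i, f i '' K ⊆ K) (hc : IsCompact K)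
    (hne : K.Nonempty) (hs : 0 ≤ s) (hsum : ∑ i, (Dilation.ratio (f i) : ℝ) ^ s = 1) :
    μH[s] K ≠ 0 := by
  let : TopologicalSpace ι := ⊥
  have : DiscreteTopology ι := ⟨rfl⟩
  let : MeasurableSpace ι := ⊤
  have : BorelSpace ι := ⟨borel_eq_top_of_discrete.symm⟩
  obtain ⟨π, hπ⟩ := exists_forall_isAddress hK hc hne
  have hπc := continuous_of_isAddress hf hc.isBounded hπ
  obtain ⟨P, _, hP⟩ := exists_isProbabilityMeasure_initialWord_le hs hsum
  obtain ⟨N, hN⟩ := hV.exists_measure_inter_preimage_le hf hc.isBounded hs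
  have hmass : ∀ U, ediam U ≤ 1 → P.map π U ≤ (N + 1 : ℝ≥0) * ediam U ^ s := fun U hU => by
    rw [← ediam_closure] at hU ⊢
    have hle := hN P 1 univ π (fun w => {ω | initialWord ω w.length = w})
      (by simpa only [ENNReal.coe_one, one_mul] using hP)
      (fun ω _ => ⟨ω, hπ ω, fun n => by simp [length_initialWord]⟩) (closure U)
      (hU.trans_lt ENNReal.one_lt_top).ne
    calc P.map π U ≤ P.map π (closure U) := measure_mono subset_closure
      _ = P (univ ∩ π ⁻¹' closure U) := by
        rw [univ_inter, Measure.map_apply hπc.measurable measurableSet_closure]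
      _ ≤ (N + 1 : ℝ≥0) * ediam (closure U) ^ s := hle.trans (by gcongr; simp)
  have hPK : P.map π K = 1 := by
    have hpre : π ⁻¹' K = univ := eq_univ_of_forall fun ω => by
      simpa [initialWord] using hπ ω 0
    rw [Measure.map_apply hπc.measurable hc.measurableSet, hpre, measure_univ]
  intro hzero
  have hle := le_smul_hausdorffMeasure (by positivity) hmass K
  simp [hPK, hzero] at hle

lemma exists_sum_ratio_rpow_eq_one {X : Type*} [PseudoEMetricSpace X] [Fintype ι] [Nonempty ι]
    {f : ι → X ≃ᵈ X} (hf : ∀ i, Dilation.ratio (f i) < 1) :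
    ∃ s : ℝ, 0 ≤ s ∧ ∑ i, (Dilation.ratio (f i) : ℝ) ^ s = 1 := by
  have hpos : ∀ i, (0 : ℝ) < Dilation.ratio (f i) := fun i => mod_cast Dilation.ratio_pos (f i)
  have hlim : Tendsto (fun s : ℝ => ∑ i, (Dilation.ratio (f i) : ℝ) ^ s) atTop (𝓝 0) := by
    simpa using tendsto_finsetSum Finset.univ fun i _ => tendsto_rpow_atTop_of_base_lt_one
      (Dilation.ratio (f i) : ℝ) (by linarith [hpos i]) (mod_cast hf i)
  obtain ⟨M, hM, hM0⟩ := ((hlim.eventually_lt_const one_pos).and (eventually_ge_atTop 0)).exists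
  have hcont : ContinuousOn (fun s : ℝ => ∑ i, (Dilation.ratio (f i) : ℝ) ^ s) (Icc 0 M) :=
    (continuous_finsetSum _ fun i _ => Real.continuous_const_rpow (hpos i).ne').continuousOn
  have hzero : 1 ≤ ∑ i, (Dilation.ratio (f i) : ℝ) ^ (0 : ℝ) := by
    simpa using mod_cast Fintype.card_pos (α := ι)
  obtain ⟨s, hs, h⟩ := intermediate_value_Icc' hM0 hcont ⟨hM.le, hzero⟩
  exact ⟨s, hs.1, h⟩

theorem OpenSetCondition.exists_dimH_eq [Finite ι] (hV : OpenSetCondition f V)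
    (hf : ∀ i, Dilation.ratio (f i) < 1) (hK : K = ⋃ i, f i '' K) (hc : IsCompact K)
    (hne : K.Nonempty) : ∃ s : ℝ≥0, dimH K = s ∧ μH[s] K ≠ 0 ∧ μH[s] K ≠ ∞ := by
  have := Fintype.ofFinite ι
  obtain ⟨i, -⟩ := nonempty_iUnion.1 (hK ▸ hne)
  have : Nonempty ι := ⟨i⟩
  obtain ⟨s, hs, hsum⟩ := exists_sum_ratio_rpow_eq_one hf
  lift s to ℝ≥0 using hs
  have hsub : ∀ i, f i '' K ⊆ K := fun i => (subset_iUnion (f · '' K) i).trans hK.ge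
  have hpos := hV.hausdorffMeasure_ne_zero hf hsub hc hne s.2 hsum
  have hfin := (hausdorffMeasure_lt_top_of_sum_ratio_rpow hf hK hc.isBounded s.2 hsum).ne
  exact ⟨s, dimH_of_hausdorffMeasure_ne_zero_ne_top hpos hfin, hpos, hfin⟩

lemma exists_mem_image_wordMap_of_mem {X : Type*} [PseudoEMetricSpace X] [Finite ι]
    {f : ι → X ≃ᵈ X} {K : Set X} (hf : ∀ i, Dilation.ratio (f i) < 1) (hK : K = ⋃ i, f i '' K) :
    ∃ m : ℝ≥0, 0 < m ∧ ∀ x ∈ K, ∀ d : ℝ≥0, 0 < d → d < 1 →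
      ∃ w, x ∈ wordMap f w '' K ∧ m * d ≤ Dilation.ratio (wordMap f w) ∧
        Dilation.ratio (wordMap f w) ≤ d := by
  obtain ⟨m, hm, hfm⟩ := exists_pos_le_ratio f
  refine ⟨m, hm, fun x hx d hd hd1 => ?_⟩
  obtain ⟨ω, hω⟩ := exists_isAddress hK hx
  obtain ⟨n, hn⟩ := exists_isStopping_initialWord hf ω hd
  refine ⟨_, hω n, hn.mul_le_ratio hfm fun hnil => ?_, hn.1⟩
  have hle := hn.1
  rw [hnil, wordMap_nil] at hle
  exact hd1.not_ge ((Dilation.ratio_id (α := X)).symm.trans_le hle)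

end Moran

section Mollification

variable (E : Type*) [NormedAddCommGroup E] [NormedSpace ℝ E] [FiniteDimensional ℝ E]

set_option maxSynthPendingDepth 3 in
lemma exists_mollification_one : ∃ M : ℝ, 0 ≤ M ∧ ∀ g : E → ℝ, Continuous g →
    ∃ G : E → ℝ, ContDiff ℝ 1 G ∧ ∀ z c δ, (∀ y ∈ closedBall z 1, |g y - c| ≤ δ) →
      |G z - c| ≤ δ ∧ ‖fderiv ℝ G z‖ ≤ M * δ := by
  borelize E
  let μ : Measure E := Measure.addHaar
  let b : ContDiffBump (0 : E) := ⟨1 / 4, 1 / 2, by norm_num, by norm_num⟩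
  let φ : E → ℝ := b.normed μ
  let L : ℝ →L[ℝ] ℝ →L[ℝ] ℝ := ContinuousLinearMap.lsmul ℝ ℝ
  have hφ : ContDiff ℝ 1 φ := b.contDiff_normed
  have hφc : HasCompactSupport φ := b.hasCompactSupport_normed
  have hφ' : Integrable (fderiv ℝ φ) μ :=
    (hφ.continuous_fderiv one_ne_zero).integrable_of_hasCompactSupport (hφc.fderiv ℝ)
  have hsupp : tsupport φ ⊆ ball 0 1 := by
    rw [b.tsupport_normed_eq]
    exact closedBall_subset_ball (by norm_num [b])
  refine ⟨‖L.precompL E‖ * ∫ t, ‖fderiv ℝ φ t‖ ∂μ, by positivity, fun g hg => ?_⟩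
  refine ⟨convolution φ g L μ, hφc.contDiff_convolution_left L hφ hg.locallyIntegrable,
    fun z c δ hδ => ?_⟩
  have hδ0 : 0 ≤ δ := (abs_nonneg _).trans (hδ z (mem_closedBall_self zero_le_one))
  have hgc : Continuous fun y => g y - c := hg.sub continuous_const
  have hsplit : convolution φ g L μ = fun y => convolution φ (fun y => g y - c) L μ y + c := by
    ext y
    have hex {k : E → ℝ} (hk : Continuous k) : ConvolutionExistsAt φ k y L μ :=
      hφc.convolutionExists_left L hφ.continuous hk.locallyIntegrable y
    have hconst : convolution φ (fun _ => c) L μ y = c :=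
      b.normed_convolution_eq_right fun _ _ => rfl
    have hadd := (hex hgc).distrib_add (hex (continuous_const (y := c)))
    simpa only [hconst, funext fun x => sub_add_cancel (g x) c, Pi.add_def] using hadd
  constructor
  · exact dist_convolution_le hδ0 ((subset_tsupport φ).trans hsupp) b.nonneg_normed
      b.integral_normed hg.aestronglyMeasurable fun y hy => hδ y (ball_subset_closedBall hy)
  · rw [hsplit, fderiv_add_const,
      (hφc.hasFDerivAt_convolution_left L hφ hgc.locallyIntegrable z).fderiv]
    simpa using dist_convolution_le' (L.precompL E) (z₀ := 0) hδ0 hφ'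
      ((support_fderiv_subset ℝ).trans hsupp) hgc.aestronglyMeasurable
      fun y hy => by simpa using hδ y (ball_subset_closedBall hy)

lemma exists_mollification : ∃ M : ℝ, 0 ≤ M ∧ ∀ ε : ℝ, 0 < ε → ∀ g : E → ℝ, Continuous g →
    ∃ G : E → ℝ, ContDiff ℝ 1 G ∧ ∀ z c δ, (∀ y ∈ closedBall z ε, |g y - c| ≤ δ) →
      |G z - c| ≤ δ ∧ ‖fderiv ℝ G z‖ ≤ M * δ / ε := by
  obtain ⟨M, hM, hmol⟩ := exists_mollification_one E
  refine ⟨M, hM, fun ε hε g hg => ?_⟩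
  obtain ⟨G, hG, hGb⟩ := hmol (fun u => g (ε • u)) (by fun_prop)
  refine ⟨fun z => G (ε⁻¹ • z), hG.comp (contDiff_const_smul _), fun z c δ hδ => ?_⟩
  have hscaled : ∀ u ∈ closedBall (ε⁻¹ • z) 1, |g (ε • u) - c| ≤ δ := by
    intro u hu
    refine hδ _ ?_
    have := smul_mem_smul_set (a := ε) hu
    rwa [smul_closedBall' hε.ne', smul_inv_smul₀ hε.ne', mul_one, Real.norm_of_nonneg hε.le] at this
  obtain ⟨hval, hder⟩ := hGb _ c δ hscaled
  refine ⟨hval, ?_⟩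
  rw [fderiv_comp_smul, norm_smul, norm_inv, Real.norm_of_nonneg hε.le, div_eq_inv_mul]
  exact mul_le_mul_of_nonneg_left hder (inv_nonneg.2 hε.le)

end Mollification

section HolderExtension

lemma rpow_add_le_two_rpow_mul {a b α : ℝ} (ha : 0 ≤ a) (hb : 0 ≤ b) (hα : 0 ≤ α) :
    (a + b) ^ α ≤ 2 ^ α * (a ^ α + b ^ α) := by
  have hmax : max a b ^ α ≤ a ^ α + b ^ α := by
    rcases max_choice a b with h | h <;> rw [h]
    · exact le_add_of_nonneg_right (Real.rpow_nonneg hb α)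
    · exact le_add_of_nonneg_left (Real.rpow_nonneg ha α)
  calc (a + b) ^ α ≤ (2 * max a b) ^ α :=
        Real.rpow_le_rpow (by positivity) (by linarith [le_max_left a b, le_max_right a b]) hα
    _ = 2 ^ α * max a b ^ α := Real.mul_rpow zero_le_two (ha.trans (le_max_left a b))
    _ ≤ 2 ^ α * (a ^ α + b ^ α) := by gcongr

lemma continuous_of_abs_sub_le_rpow {X : Type*} [PseudoMetricSpace X] {f : X → ℝ} {C α : ℝ}
    (hα : 0 < α) (hf : ∀ x y, |f x - f y| ≤ C * dist x y ^ α) : Continuous f := by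
  refine continuous_iff_continuousAt.2 fun y => tendsto_iff_dist_tendsto_zero.2 ?_
  refine squeeze_zero (fun _ => dist_nonneg) (fun x => hf x y) ?_
  have hdist : Tendsto (fun x => dist x y) (𝓝 y) (𝓝 0) :=
    tendsto_iff_dist_tendsto_zero.1 tendsto_id
  simpa [Real.zero_rpow hα.ne'] using (hdist.rpow_const (Or.inr hα.le)).const_mul C

/- The extension is McShane's infimum `⨅ y, f y + B * dist z y ^ α`. As `dist ^ α` is not a metric
for `1 < α`, the constant is enlarged to make up for the triangle inequality. -/
lemma exists_continuous_abs_sub_le_rpow {X : Type*} [PseudoMetricSpace X] {K : Set X}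
    (hK : IsCompact K) (hne : K.Nonempty) {f : K → ℝ} {C α : ℝ} (hα : 0 < α)
    (hf : ∀ x y : K, |f x - f y| ≤ C * dist x y ^ α) :
    ∃ (g : X → ℝ) (B : ℝ), Continuous g ∧ 0 ≤ B ∧
      ∀ (z : X) (x : K), |g z - f x| ≤ B * dist z x ^ α := by
  have : CompactSpace K := isCompact_iff_compactSpace.1 hK
  have : Nonempty K := hne.to_subtype
  set B := |C| * 2 ^ α with hB
  let k : X → K → ℝ := fun z x => f x + B * dist z x ^ α
  have hk : Continuous ↿k := by
    have hdist : Continuous fun p : X × K => dist p.1 (p.2 : X) ^ α :=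
      (by fun_prop : Continuous fun p : X × K => dist p.1 (p.2 : X)).rpow_const
        fun _ => Or.inr hα.le
    exact ((continuous_of_abs_sub_le_rpow hα hf).comp continuous_snd).add
      (hdist.const_mul B)
  have hlow : ∀ (z : X) (x y : K), f x - B * dist z x ^ α ≤ k z y := by
    intro z x y
    have hfxy : f x - f y ≤ B * (dist z x ^ α + dist z y ^ α) :=
      calc f x - f y ≤ C * dist x y ^ α := (le_abs_self _).trans (hf x y)
        _ ≤ |C| * dist (x : X) y ^ α := by
          rw [Subtype.dist_eq]
          gcongr
          exact le_abs_self C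
        _ ≤ |C| * (dist z x + dist z y) ^ α := by
          gcongr
          exact dist_triangle_left _ _ _
        _ ≤ |C| * (2 ^ α * (dist z x ^ α + dist z y ^ α)) := by
          gcongr
          exact rpow_add_le_two_rpow_mul dist_nonneg dist_nonneg hα.le
        _ = B * (dist z x ^ α + dist z y ^ α) := by rw [hB, mul_assoc]
    simp only [k]
    linarith
  refine ⟨fun z => ⨅ x, k z x, B, ?_, by positivity, fun z x => abs_le.2 ⟨?_, ?_⟩⟩
  · simpa only [image_univ, sInf_range] using isCompact_univ.continuous_sInf hk
  · linarith [le_ciInf (hlow z x)]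
  · have hinf : ⨅ y, k z y ≤ k z x := ciInf_le ⟨_, forall_mem_range.2 (hlow z x)⟩ x
    simp only [k] at hinf ⊢
    linarith

variable {E : Type*} [NormedAddCommGroup E] [NormedSpace ℝ E]

lemma exists_contDiff_abs_sub_le_rpow [FiniteDimensional ℝ E] {K : Set E} (hK : IsCompact K)
    (hne : K.Nonempty) {f : K → ℝ} {C α : ℝ} (hα : 0 < α)
    (hf : ∀ x y : K, |f x - f y| ≤ C * dist x y ^ α) :
    ∃ A : ℝ, 0 ≤ A ∧ ∀ ε, 0 < ε → ∃ G : E → ℝ, ContDiff ℝ 1 G ∧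
      ∀ r, ε ≤ r → ∀ (z : E) (x : K), dist z x ≤ r →
        |G z - f x| ≤ A * r ^ α ∧ ‖fderiv ℝ G z‖ ≤ A * r ^ α / ε := by
  obtain ⟨g, B, hg, hB, hgf⟩ := exists_continuous_abs_sub_le_rpow hK hne hα hf
  obtain ⟨M, hM, hmol⟩ := exists_mollification E
  refine ⟨(1 + M) * (B * 2 ^ α), by positivity, fun ε hε => ?_⟩
  obtain ⟨G, hG, hGb⟩ := hmol ε hε g hg
  refine ⟨G, hG, fun r hr z x hzx => ?_⟩
  have hr0 : 0 ≤ r := hε.le.trans hr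
  have hosc : ∀ y ∈ closedBall z ε, |g y - f x| ≤ B * 2 ^ α * r ^ α := by
    intro y hy
    rw [mul_assoc, ← Real.mul_rpow zero_le_two hr0]
    refine (hgf y x).trans ?_
    gcongr
    linarith [dist_triangle y z x, mem_closedBall.1 hy]
  obtain ⟨hval, hder⟩ := hGb z (f x) _ hosc
  constructor
  · refine hval.trans ?_
    rw [mul_assoc (1 + M)]
    exact le_mul_of_one_le_left (by positivity) (by linarith)
  · refine hder.trans ?_
    rw [mul_assoc (1 + M)]
    gcongr
    linarith

lemma exists_cutoff [FiniteDimensional ℝ E] (K : Set E) :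
    ∃ M : ℝ, 0 ≤ M ∧ ∀ ε, 0 < ε → ∃ X : E → ℝ, ContDiff ℝ 1 X ∧
      (∀ z, |X z| ≤ 1 ∧ ‖fderiv ℝ X z‖ ≤ M / ε) ∧
      (∀ x ∈ K, X x = 1 ∧ fderiv ℝ X x = 0) ∧
      ∀ z, 4 * ε ≤ infDist z K → X z = 0 ∧ fderiv ℝ X z = 0 := by
  obtain ⟨M, hM, hmol⟩ := exists_mollification E
  refine ⟨M, hM, fun ε hε => ?_⟩
  let k : E → ℝ := fun u => max 0 (min 1 (3 - infDist u K / ε))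
  have hk : Continuous k := continuous_const.max (continuous_const.min
    (continuous_const.sub ((continuous_infDist_pt K).div_const _)))
  have hlocal : ∀ X : E → ℝ, ∀ {z c δ}, (|X z - c| ≤ δ ∧ ‖fderiv ℝ X z‖ ≤ M * δ / ε) → δ = 0 →
      X z = c ∧ fderiv ℝ X z = 0 := by
    rintro X z c _ ⟨hval, hder⟩ rfl
    exact ⟨sub_eq_zero.1 (abs_nonpos_iff.1 hval), norm_le_zero_iff.1 (by simpa using hder)⟩
  obtain ⟨X, hX, hXb⟩ := hmol ε hε k hk
  refine ⟨X, hX, fun z => ?_, fun x hx => hlocal X (hXb x 1 0 fun y hy => ?_) rfl,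
    fun z hz => hlocal X (hXb z 0 0 fun y hy => ?_) rfl⟩
  · have hk1 : ∀ y, |k y - 0| ≤ 1 := fun y => by
      rw [sub_zero, abs_of_nonneg (le_max_left _ _)]
      exact max_le zero_le_one (min_le_left _ _)
    simpa using hXb z 0 1 fun y _ => hk1 y
  · have hy1 : infDist y K / ε ≤ 1 := (div_le_one hε).2 ((infDist_le_dist_of_mem hx).trans hy)
    have hky : k y = 1 := by
      simp only [k]
      rw [min_eq_left (by linarith), max_eq_right zero_le_one]
    simp [hky]
  · have hyz : infDist z K ≤ infDist y K + dist z y := infDist_le_infDist_add_dist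
    have hy3 : 3 ≤ infDist y K / ε := (le_div_iff₀ hε).2 (by linarith [mem_closedBall'.1 hy])
    have hky : k y = 0 := max_eq_left ((min_le_right _ _).trans (by linarith))
    simp [hky]

lemma exists_localization [FiniteDimensional ℝ E] (K : Set E) :
    ∃ M : ℝ, 0 ≤ M ∧ ∀ (ε δ : ℝ) (H : E → ℝ), 0 < ε → 0 ≤ δ → ContDiff ℝ 1 H →
      (∀ z, infDist z K < 4 * ε → |H z| ≤ δ ∧ ‖fderiv ℝ H z‖ ≤ δ / ε) →
      ∃ D : E → ℝ, ContDiff ℝ 1 D ∧ (∀ z, |D z| ≤ δ ∧ ‖fderiv ℝ D z‖ ≤ M * (δ / ε)) ∧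
        ∀ x ∈ K, D x = H x ∧ fderiv ℝ D x = fderiv ℝ H x := by
  obtain ⟨M, hM, hcut⟩ := exists_cutoff K
  refine ⟨1 + M, by positivity, fun ε δ H hε hδ hH hHb => ?_⟩
  obtain ⟨X, hX, hX1, hXK, hX0⟩ := hcut ε hε
  have hderiv : ∀ z, fderiv ℝ (fun z => X z * H z) z = X z • fderiv ℝ H z + H z • fderiv ℝ X z :=
    fun z => fderiv_fun_mul (hX.differentiable one_ne_zero z) (hH.differentiable one_ne_zero z)
  refine ⟨fun z => X z * H z, hX.mul hH, fun z => ?_, fun x hx => ?_⟩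
  · rw [hderiv, abs_mul]
    rcases le_or_gt (4 * ε) (infDist z K) with hz | hz
    · obtain ⟨hval, hder⟩ := hX0 z hz
      simp only [hval, hder, abs_zero, zero_mul, zero_smul, smul_zero, add_zero, norm_zero]
      exact ⟨hδ, by positivity⟩
    · obtain ⟨hHz, hdHz⟩ := hHb z hz
      obtain ⟨hXz, hdXz⟩ := hX1 z
      refine ⟨(mul_le_of_le_one_left (abs_nonneg _) hXz).trans hHz, ?_⟩
      calc ‖X z • fderiv ℝ H z + H z • fderiv ℝ X z‖
          ≤ |X z| * ‖fderiv ℝ H z‖ + |H z| * ‖fderiv ℝ X z‖ := by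
            simpa only [norm_smul, Real.norm_eq_abs] using
              norm_add_le (X z • fderiv ℝ H z) (H z • fderiv ℝ X z)
        _ ≤ 1 * (δ / ε) + δ * (M / ε) := by gcongr
        _ = (1 + M) * (δ / ε) := by ring
  · obtain ⟨hval, hder⟩ := hXK x hx
    simp [hderiv, hval, hder]

lemma exists_contDiff_of_telescoping {F : Type*} [NormedAddCommGroup F] [NormedSpace ℝ F]
    [CompleteSpace F] {K : Set E} {G D : ℕ → E → F} {u : ℕ → ℝ} {f : K → F} {f' : K → E →L[ℝ] F}
    (hG : ∀ n, ContDiff ℝ 1 (G n)) (hD : ∀ n, ContDiff ℝ 1 (D n)) (hu : Summable u)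
    (hDu : ∀ n z, ‖D n z‖ ≤ u n ∧ ‖fderiv ℝ (D n) z‖ ≤ u n)
    (hDG : ∀ n, ∀ x ∈ K, D n x = G (n + 1) x - G n x ∧
      fderiv ℝ (D n) x = fderiv ℝ (G (n + 1)) x - fderiv ℝ (G n) x)
    (hf : ∀ x : K, Tendsto (fun n => G n x) atTop (𝓝 (f x)))
    (hf' : ∀ x : K, Tendsto (fun n => fderiv ℝ (G n) x) atTop (𝓝 (f' x))) :
    ∃ g : E → F, ContDiff ℝ 1 g ∧ ∀ x : K, g x = f x ∧ fderiv ℝ g x = f' x := by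
  have htsum : ContDiff ℝ 1 fun z => ∑' n, D n z := by
    refine contDiff_tsum (N := 1) (v := fun _ => u) hD (fun _ _ => hu) ?_
    intro j n z hj
    obtain rfl | rfl : j = 0 ∨ j = 1 := Nat.le_one_iff_eq_zero_or_eq_one.1 (by exact_mod_cast hj)
    · exact norm_iteratedFDeriv_zero.trans_le (hDu n z).1
    · exact (norm_iteratedFDeriv_one (D n)).trans_le (hDu n z).2
  refine ⟨fun z => G 0 z + ∑' n, D n z, (hG 0).add htsum, fun x => ⟨?_, ?_⟩⟩
  · have hval : ∑' n, D n x = f x - G 0 x := by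
      have hsum := Summable.of_norm_bounded hu fun n => (hDu n x).1
      refine (hsum.hasSum_iff_tendsto_nat.2 ?_).tsum_eq
      simp only [(hDG _ x x.2).1, Finset.sum_range_sub fun n => G n x]
      exact (hf x).sub_const _
    exact (congrArg (G 0 x + ·) hval).trans (add_sub_cancel _ _)
  · have hder : ∑' n, fderiv ℝ (D n) x = f' x - fderiv ℝ (G 0) x := by
      have hsum := Summable.of_norm_bounded hu fun n => (hDu n x).2
      refine (hsum.hasSum_iff_tendsto_nat.2 ?_).tsum_eq
      simp only [(hDG _ x x.2).2, Finset.sum_range_sub fun n => fderiv ℝ (G n) x]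
      exact (hf' x).sub_const _
    rw [fderiv_fun_add ((hG 0).differentiable one_ne_zero x) (htsum.differentiable one_ne_zero x),
      fderiv_tsum_apply hu (fun n => (hD n).differentiable one_ne_zero) (fun n z => (hDu n z).2)
        (Summable.of_norm_bounded hu fun n => (hDu n x).1) (x : E), hder, add_sub_cancel]

lemma exists_seq_contDiff_abs_sub_le [FiniteDimensional ℝ E] {K : Set E} (hK : IsCompact K)
    (hne : K.Nonempty) {f : K → ℝ} {C α : ℝ} (hα : 1 < α)
    (hf : ∀ x y : K, |f x - f y| ≤ C * dist x y ^ α) :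
    ∃ (A θ : ℝ) (G : ℕ → E → ℝ), 0 ≤ A ∧ 0 ≤ θ ∧ θ < 1 ∧ (∀ n, ContDiff ℝ 1 (G n)) ∧
      ∀ n, ∀ m ∈ Icc n (n + 1), ∀ (z : E) (x : K), dist z x ≤ 4 * (1 / 2) ^ n →
        |G m z - f x| ≤ A * θ ^ n * (1 / 2) ^ n ∧ ‖fderiv ℝ (G m) z‖ ≤ A * θ ^ n := by
  obtain ⟨A, hA, happrox⟩ := exists_contDiff_abs_sub_le_rpow hK hne (by linarith) hf
  choose G hG hGb using fun n : ℕ => happrox ((1 / 2) ^ n) (by positivity)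
  let θ : ℝ := (1 / 2) ^ (α - 1)
  have hscale : ∀ n : ℕ, (4 * (1 / 2) ^ n : ℝ) ^ α = 4 ^ α * θ ^ n * (1 / 2) ^ n := by
    intro n
    rw [Real.mul_rpow (by norm_num) (by positivity), mul_assoc, ← mul_pow,
      ← Real.rpow_add_one (by norm_num), sub_add_cancel, Real.rpow_pow_comm (by norm_num)]
  refine ⟨2 * (A * 4 ^ α), θ, G, by positivity, by positivity,
    Real.rpow_lt_one (by norm_num) (by norm_num) (by linarith), hG, fun n m hm z x hzx => ?_⟩
  have hmn : (1 / 2 : ℝ) ^ m ≤ (1 / 2) ^ n :=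
    pow_le_pow_of_le_one (by norm_num) (by norm_num) hm.1
  have hnm : (1 / 2 : ℝ) ^ n / 2 ≤ (1 / 2) ^ m :=
    (by rw [pow_succ]; ring : (1 / 2 : ℝ) ^ n / 2 = (1 / 2) ^ (n + 1)).trans_le
      (pow_le_pow_of_le_one (by norm_num) (by norm_num) hm.2)
  have hpos : (0 : ℝ) < (1 / 2) ^ n := by positivity
  obtain ⟨hval, hder⟩ := hGb m _ (by linarith) z x hzx
  rw [hscale] at hval hder
  constructor
  · calc |G m z - f x| ≤ 1 * (A * 4 ^ α) * θ ^ n * (1 / 2) ^ n := hval.trans_eq (by ring)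
      _ ≤ 2 * (A * 4 ^ α) * θ ^ n * (1 / 2) ^ n := by gcongr; norm_num
  · calc ‖fderiv ℝ (G m) z‖ ≤ A * (4 ^ α * θ ^ n * (1 / 2) ^ n) / ((1 / 2) ^ n / 2) :=
          hder.trans (by gcongr)
      _ = 2 * (A * 4 ^ α) * θ ^ n := by field_simp

lemma exists_localization_sub [FiniteDimensional ℝ E] {K : Set E} {G : ℕ → E → ℝ} {A θ : ℝ}
    (hA : 0 ≤ A) (hθ : 0 ≤ θ) (hG : ∀ n, ContDiff ℝ 1 (G n))
    (hGb : ∀ n z, infDist z K < 4 * (1 / 2) ^ n →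
      |G (n + 1) z - G n z| ≤ A * θ ^ n * (1 / 2) ^ n ∧
        ‖fderiv ℝ (G (n + 1)) z - fderiv ℝ (G n) z‖ ≤ A * θ ^ n) :
    ∃ (B : ℝ) (D : ℕ → E → ℝ), (∀ n, ContDiff ℝ 1 (D n)) ∧
      (∀ n z, ‖D n z‖ ≤ B * θ ^ n ∧ ‖fderiv ℝ (D n) z‖ ≤ B * θ ^ n) ∧
      ∀ n, ∀ x ∈ K, D n x = G (n + 1) x - G n x ∧
        fderiv ℝ (D n) x = fderiv ℝ (G (n + 1)) x - fderiv ℝ (G n) x := by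
  obtain ⟨M, hM, hloc⟩ := exists_localization K
  have hsub : ∀ n z, fderiv ℝ (fun z => G (n + 1) z - G n z) z =
      fderiv ℝ (G (n + 1)) z - fderiv ℝ (G n) z := fun n z =>
    fderiv_fun_sub ((hG _).differentiable one_ne_zero z) ((hG _).differentiable one_ne_zero z)
  have hdiv : ∀ n : ℕ, A * θ ^ n * (1 / 2) ^ n / (1 / 2) ^ n = A * θ ^ n := fun n =>
    mul_div_cancel_right₀ _ (by positivity)
  choose D hD hDb hDK using fun n => hloc ((1 / 2) ^ n) (A * θ ^ n * (1 / 2) ^ n)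
    (fun z => G (n + 1) z - G n z) (by positivity) (by positivity) ((hG _).sub (hG n))
    (by simpa only [hsub, hdiv] using hGb n)
  refine ⟨(1 + M) * A, D, hD, fun n z => ?_, fun n x hx => by simpa only [hsub] using hDK n x hx⟩
  have hhalf : (1 / 2 : ℝ) ^ n ≤ 1 := pow_le_one₀ (by norm_num) (by norm_num)
  have hAθ : 0 ≤ A * θ ^ n := by positivity
  obtain ⟨hval, hder⟩ := hDb n z
  rw [hdiv] at hder
  exact ⟨hval.trans (by nlinarith), hder.trans (by nlinarith)⟩

/- The mollifications `G n` at scale `2⁻ⁿ` converge to `f` on `K`. Cutting off their differences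
outside the `2⁻ⁿ`-neighbourhoods of `K`, where they are not controlled, does not change the sum of
the series on `K`. -/
theorem exists_contDiff_extension_of_rpow [FiniteDimensional ℝ E] {K : Set E} (hK : IsCompact K)
    {f : K → ℝ} {C α : ℝ} (hα : 1 < α) (hf : ∀ x y : K, |f x - f y| ≤ C * dist x y ^ α) :
    ∃ F : E → ℝ, ContDiff ℝ 1 F ∧ ∀ x : K, F x = f x ∧ fderiv ℝ F x = 0 := by
  rcases K.eq_empty_or_nonempty with rfl | hne
  · exact ⟨0, contDiff_const, isEmptyElim⟩
  obtain ⟨A, θ, G, hA, hθ0, hθ1, hG, hGb⟩ := exists_seq_contDiff_abs_sub_le hK hne hα hf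
  have hGK : ∀ n, ∀ x : K, |G n x - f x| ≤ A * θ ^ n * (1 / 2) ^ n ∧
      ‖fderiv ℝ (G n) x‖ ≤ A * θ ^ n := fun n x =>
    hGb n n ⟨le_rfl, n.le_succ⟩ x x (by rw [dist_self]; positivity)
  obtain ⟨B, D, hD, hDb, hDK⟩ :=
    exists_localization_sub (K := K) (A := 2 * A) (by positivity) hθ0 hG fun n z hz => by
      obtain ⟨x, hx, hzx⟩ := (infDist_lt_iff hne).1 hz
      obtain ⟨hval, hder⟩ := hGb n n ⟨le_rfl, n.le_succ⟩ z ⟨x, hx⟩ hzx.le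
      obtain ⟨hval', hder'⟩ := hGb n (n + 1) ⟨n.le_succ, le_rfl⟩ z ⟨x, hx⟩ hzx.le
      rw [abs_sub_comm] at hval
      exact ⟨(abs_sub_le _ (f ⟨x, hx⟩) _).trans (by linarith),
        (norm_sub_le _ _).trans (by linarith)⟩
  have hgeom : Tendsto (fun n => A * θ ^ n) atTop (𝓝 0) := by
    simpa using (tendsto_pow_atTop_nhds_zero_of_lt_one hθ0 hθ1).const_mul A
  refine exists_contDiff_of_telescoping hG hD
    ((summable_geometric_of_lt_one hθ0 hθ1).mul_left B) hDb hDK (fun x => ?_)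
    fun x => squeeze_zero_norm (fun n => (hGK n x).2) hgeom
  refine tendsto_iff_dist_tendsto_zero.2 (squeeze_zero (fun _ => dist_nonneg) (fun n => ?_) hgeom)
  exact (hGK n x).1.trans
    (mul_le_of_le_one_right (by positivity) (pow_le_one₀ (by norm_num) (by norm_num)))

end HolderExtension

section Arc

lemma subset_uIcc_of_ordConnected {α : Type*} [LinearOrder α] {T : Set α} (hT : T.OrdConnected)
    {a b c : α} (ha : a ∉ T) (hb : b ∉ T) (hc : c ∈ T) (hc' : c ∈ uIcc a b) : T ⊆ uIcc a b := by
  intro d hd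
  have hcd : uIcc c d ⊆ T := hT.uIcc_subset hc hd
  by_contra hd'
  have hab : a ∈ uIcc c d ∨ b ∈ uIcc c d := by
    simp only [mem_uIcc] at hc' hd' ⊢
    grind
  exact hab.elim (fun h => ha (hcd h)) fun h => hb (hcd h)

lemma exists_diam_div_le_dist_of_isPreconnected {X : Type*} [PseudoMetricSpace X] {Q : Set X}
    (hQ : IsPreconnected Q) {x y : X} (hx : x ∈ Q) (hy : y ∈ Q) (hd : 0 < diam Q) :
    ∃ p ∈ Q, diam Q / 8 ≤ dist p x ∧ diam Q / 8 ≤ dist p y := by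
  by_contra! hcon
  have hcov : Q ⊆ ball x (diam Q / 8) ∪ ball y (diam Q / 8) := fun p hp =>
    (lt_or_ge (dist p x) (diam Q / 8)).imp id (hcon p hp)
  obtain ⟨q, -, hqx, hqy⟩ := hQ _ _ isOpen_ball isOpen_ball hcov
    ⟨x, hx, mem_ball_self (by positivity)⟩ ⟨y, hy, mem_ball_self (by positivity)⟩
  have hxy : dist y x ≤ diam Q / 8 + diam Q / 8 :=
    (dist_triangle_left _ _ q).trans (add_le_add hqy.le hqx.le)
  have hsub : Q ⊆ closedBall x (3 * diam Q / 8) := by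
    intro p hp
    rw [mem_closedBall]
    rcases hcov hp with hpx | hpy
    · linarith [mem_ball.1 hpx]
    · linarith [mem_ball.1 hpy, dist_triangle p y x]
  linarith [diam_le_of_subset_closedBall (by positivity) hsub]

lemma one_le_dimH_of_isPreconnected {X : Type*} [MetricSpace X] {Q : Set X}
    (hQ : IsPreconnected Q) (hne : Q.Nontrivial) : 1 ≤ dimH Q := by
  obtain ⟨a, ha, b, hb, hab⟩ := hne
  have hL : LipschitzWith 1 fun z => dist a z := LipschitzWith.dist_right a
  have hIcc : Icc 0 (dist a b) ⊆ (fun z => dist a z) '' Q :=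
    (hQ.image _ hL.continuous.continuousOn).Icc_subset ⟨a, ha, dist_self a⟩ ⟨b, hb, rfl⟩
  have hint : (interior (Icc 0 (dist a b))).Nonempty := by
    rw [interior_Icc]
    exact nonempty_Ioo.2 (dist_pos.2 hab)
  calc (1 : ℝ≥0∞) = dimH (Icc 0 (dist a b)) := by
        rw [Real.dimH_of_nonempty_interior hint, Module.finrank_self, Nat.cast_one]
    _ ≤ dimH ((fun z => dist a z) '' Q) := dimH_mono hIcc
    _ ≤ dimH Q := hL.dimH_image_le Q

variable {Λ : Set ℂ}

lemma isCompact_of_homeomorph_unitInterval (h : I ≃ₜ Λ) : IsCompact Λ :=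
  isCompact_iff_compactSpace.2 h.compactSpace

lemma isConnected_of_homeomorph_unitInterval (h : I ≃ₜ Λ) : IsConnected Λ :=
  isConnected_iff_connectedSpace.2 (h.surjective.connectedSpace h.continuous)

lemma nontrivial_of_homeomorph_unitInterval (h : I ≃ₜ Λ) : Λ.Nontrivial :=
  nontrivial_coe_sort.1 h.injective.nontrivial

variable (h : I ≃ₜ Λ)

lemma continuous_coe_comp_homeomorph : Continuous fun u => (h u : ℂ) :=
  continuous_subtype_val.comp h.continuous

lemma ordConnected_setOf_homeomorph_mem {Q : Set ℂ} (hQ : Q ⊆ Λ) (hc : IsPreconnected Q) :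
    {u | (h u : ℂ) ∈ Q}.OrdConnected := by
  have himage : (fun u => (h u : ℂ)) '' {u | (h u : ℂ) ∈ Q} = Q :=
    (image_preimage_subset _ Q).antisymm fun z hz =>
      ⟨h.symm ⟨z, hQ hz⟩, by simpa using hz, by simp⟩
  refine IsPreconnected.ordConnected ?_
  rwa [← (IsInducing.subtypeVal.comp h.isInducing).isPreconnected_image, Function.comp_def, himage]

lemma subarc_subset (x y : Λ) : subarc h x y ⊆ Λ := by
  rintro _ ⟨u, -, rfl⟩
  exact (h u).2

lemma isCompact_subarc (x y : Λ) : IsCompact (subarc h x y) :=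
  isCompact_uIcc.image (continuous_coe_comp_homeomorph h)

lemma isPreconnected_subarc (x y : Λ) : IsPreconnected (subarc h x y) :=
  isPreconnected_uIcc.image _ (continuous_coe_comp_homeomorph h).continuousOn

lemma left_mem_subarc (x y : Λ) : (x : ℂ) ∈ subarc h x y :=
  ⟨h.symm x, left_mem_uIcc, by simp⟩

lemma right_mem_subarc (x y : Λ) : (y : ℂ) ∈ subarc h x y :=
  ⟨h.symm y, right_mem_uIcc, by simp⟩

lemma subarc_comm (x y : Λ) : subarc h x y = subarc h y x := by
  rw [subarc, subarc, uIcc_comm]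

lemma subarc_zero_one : subarc h (h 0) (h 1) = Λ := by
  refine (subarc_subset h _ _).antisymm fun z hz => ⟨h.symm ⟨z, hz⟩, ?_, by simp⟩
  rw [h.symm_apply_apply, h.symm_apply_apply, uIcc_of_le zero_le_one]
  exact ⟨bot_le, le_top⟩

lemma subarc_subset_of_isPreconnected {Q : Set ℂ} (hQ : Q ⊆ Λ) (hc : IsPreconnected Q) {x y : Λ}
    (hx : (x : ℂ) ∈ Q) (hy : (y : ℂ) ∈ Q) : subarc h x y ⊆ Q := by
  rintro _ ⟨u, hu, rfl⟩
  exact (ordConnected_setOf_homeomorph_mem h hQ hc).uIcc_subset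
    (x := h.symm x) (y := h.symm y) (by simpa using hx) (by simpa using hy) hu

lemma subset_subarc_of_isPreconnected {Q : Set ℂ} (hQ : Q ⊆ Λ) (hc : IsPreconnected Q) {x y : Λ}
    (hx : (x : ℂ) ∉ Q) (hy : (y : ℂ) ∉ Q) (hne : (Q ∩ subarc h x y).Nonempty) :
    Q ⊆ subarc h x y := by
  obtain ⟨_, hp, v, hv, rfl⟩ := hne
  have hsub := subset_uIcc_of_ordConnected (ordConnected_setOf_homeomorph_mem h hQ hc)
    (a := h.symm x) (b := h.symm y) (by simpa using hx) (by simpa using hy) hp hv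
  exact fun z hz => ⟨h.symm ⟨z, hQ hz⟩, hsub (by simpa using hz), by simp⟩

lemma subarc_eq_subarc (h h' : I ≃ₜ Λ) (x y : Λ) : subarc h x y = subarc h' x y := by
  have hsub : ∀ k k' : I ≃ₜ Λ, subarc k x y ⊆ subarc k' x y := fun k k' =>
    subarc_subset_of_isPreconnected k (subarc_subset k' x y) (isPreconnected_subarc k' x y)
      (left_mem_subarc k' x y) (right_mem_subarc k' x y)
  exact (hsub h h').antisymm (hsub h' h)

lemma subarc_union_subarc {x y z : Λ} (hxy : h.symm x ≤ h.symm y) (hyz : h.symm y ≤ h.symm z) :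
    subarc h x y ∪ subarc h y z = subarc h x z := by
  rw [subarc, subarc, subarc, ← image_union, uIcc_of_le hxy, uIcc_of_le hyz,
    uIcc_of_le (hxy.trans hyz), Icc_union_Icc_eq_Icc hxy hyz]

lemma subarc_inter_subarc_subset {x y z : Λ} (hxy : h.symm x ≤ h.symm y)
    (hyz : h.symm y ≤ h.symm z) : subarc h x y ∩ subarc h y z ⊆ {(y : ℂ)} := by
  rw [subarc, subarc, uIcc_of_le hxy, uIcc_of_le hyz]
  rintro _ ⟨⟨u, hu, rfl⟩, v, hv, huv⟩
  obtain rfl : v = u := h.injective (Subtype.ext huv)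
  simp [le_antisymm hu.2 hv.1]

lemma hausdorffMeasure_subarc_add {s : ℝ} (hs : 0 < s) {x y z : Λ} (hxy : h.symm x ≤ h.symm y)
    (hyz : h.symm y ≤ h.symm z) :
    μH[s] (subarc h x z) = μH[s] (subarc h x y) + μH[s] (subarc h y z) := by
  have := Measure.nullSingletonClass_hausdorff ℂ hs
  rw [← subarc_union_subarc h hxy hyz]
  exact measure_union₀ (isCompact_subarc h y z).measurableSet.nullMeasurableSet
    (measure_mono_null (subarc_inter_subarc_subset h hxy hyz) (measure_singleton _))

lemma abs_hausdorffFunction_sub {s : ℝ} (hs : 0 < s) (hfin : μH[s] Λ ≠ ∞) (x y : Λ) :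
    |hausdorffFunction h s x - hausdorffFunction h s y| = (μH[s] (subarc h x y)).toReal := by
  wlog hxy : h.symm x ≤ h.symm y generalizing x y
  · rw [abs_sub_comm, subarc_comm]
    exact this y x (le_of_not_ge hxy)
  have hne : ∀ z w, μH[s] (subarc h z w) ≠ ∞ := fun z w =>
    measure_ne_top_of_subset (subarc_subset h z w) hfin
  rw [hausdorffFunction, hausdorffFunction, hausdorffMeasure_subarc_add h hs (by simp) hxy,
    ENNReal.toReal_add (hne _ _) (hne _ _), sub_add_cancel_left, abs_neg,
    abs_of_nonneg ENNReal.toReal_nonneg]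

variable {ι : Type*} [Finite ι] {f : ι → ℂ ≃ᵈ ℂ} {s : ℝ}

lemma exists_image_wordMap_subset_subarc (hf : ∀ i, Dilation.ratio (f i) < 1)
    (hΛ : Λ = ⋃ i, f i '' Λ) :
    ∃ c : ℝ≥0, 0 < c ∧ ∀ x y : Λ, 0 < diam (subarc h x y) → ∃ w,
      wordMap f w '' Λ ⊆ subarc h x y ∧ c * diam (subarc h x y) ≤ Dilation.ratio (wordMap f w) := by
  obtain ⟨m, hm, hpiece⟩ := exists_mem_image_wordMap_of_mem hf hΛ
  have hb : Bornology.IsBounded Λ := (isCompact_of_homeomorph_unitInterval h).isBounded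
  have hD : 0 < diam Λ := diam_pos (nontrivial_of_homeomorph_unitInterval h) hb
  lift diam Λ to ℝ≥0 using hD.le with D hDΛ
  rw [NNReal.coe_pos] at hD
  refine ⟨m / (9 * D), by positivity, fun x y hδ => ?_⟩
  have hδD : diam (subarc h x y) ≤ D := hDΛ ▸ diam_mono (subarc_subset h x y) hb
  obtain ⟨p, hp, hpx, hpy⟩ := exists_diam_div_le_dist_of_isPreconnected
    (isPreconnected_subarc h x y) (left_mem_subarc h x y) (right_mem_subarc h x y) hδ
  lift diam (subarc h x y) to ℝ≥0 using hδ.le with δ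
  rw [NNReal.coe_pos] at hδ
  have hd : δ / (9 * D) < 1 := (div_lt_one (by positivity)).2
    ((NNReal.coe_le_coe.1 hδD).trans_lt (lt_mul_of_one_lt_left hD (by norm_num)))
  obtain ⟨w, hpw, hlow, hup⟩ := hpiece p (subarc_subset h x y hp) _ (by positivity) hd
  have hnear : ∀ q ∈ wordMap f w '' Λ, dist p q < δ / 8 := fun q hq =>
    calc dist p q ≤ diam (wordMap f w '' Λ) :=
          dist_le_diam_of_mem ((Dilation.lipschitz (wordMap f w)).isBounded_image hb) hpw hq
      _ = Dilation.ratio (wordMap f w) * D := by rw [Dilation.diam_image, hDΛ]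
      _ ≤ (δ / (9 * D) : ℝ≥0) * D := by gcongr
      _ = δ / 9 := by push_cast; field_simp
      _ < δ / 8 := by gcongr; norm_num
  have hsub : ∀ i, f i '' Λ ⊆ Λ := fun i => (subset_iUnion (f · '' Λ) i).trans hΛ.ge
  refine ⟨w, subset_subarc_of_isPreconnected h (image_wordMap_subset hsub w)
    ((isConnected_of_homeomorph_unitInterval h).isPreconnected.image _
      (Dilation.toContinuous (wordMap f w)).continuousOn)
    (fun hx => (hnear _ hx).not_ge hpx) (fun hy => (hnear _ hy).not_ge hpy) ⟨p, hpw, hp⟩, ?_⟩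
  rw [← mul_div_assoc, mul_div_right_comm] at hlow
  exact_mod_cast hlow

lemma exists_mul_diam_subarc_rpow_le (hf : ∀ i, Dilation.ratio (f i) < 1)
    (hΛ : Λ = ⋃ i, f i '' Λ) (hs : 0 < s) (hpos : μH[s] Λ ≠ 0) (hfin : μH[s] Λ ≠ ∞) :
    ∃ c : ℝ, 0 < c ∧ ∀ x y : Λ,
      c * diam (subarc h x y) ^ s ≤ (μH[s] (subarc h x y)).toReal := by
  obtain ⟨c, hc, hpiece⟩ := exists_image_wordMap_subset_subarc h hf hΛ
  have hH : 0 < (μH[s] Λ).toReal := ENNReal.toReal_pos hpos hfin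
  refine ⟨(μH[s] Λ).toReal * c ^ s, by positivity, fun x y => ?_⟩
  rcases (diam_nonneg (s := subarc h x y)).eq_or_lt with hδ | hδ
  · simp [← hδ, Real.zero_rpow hs.ne']
  obtain ⟨w, hw, hcw⟩ := hpiece x y hδ
  calc (μH[s] Λ).toReal * c ^ s * diam (subarc h x y) ^ s
      = (c * diam (subarc h x y)) ^ s * (μH[s] Λ).toReal := by
        rw [Real.mul_rpow c.coe_nonneg diam_nonneg]; ring
    _ ≤ Dilation.ratio (wordMap f w) ^ s * (μH[s] Λ).toReal := by gcongr
    _ = (μH[s] (wordMap f w '' Λ)).toReal := by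
        rw [hausdorffMeasure_image_dilationEquiv hs.le, ENNReal.toReal_mul, ← ENNReal.toReal_rpow,
          ENNReal.coe_toReal]
    _ ≤ (μH[s] (subarc h x y)).toReal :=
        ENNReal.toReal_mono (measure_ne_top_of_subset (subarc_subset h x y) hfin)
          (measure_mono hw)

end Arc

section WhitneyFunction

variable {Λ : Set ℂ} {s : ℝ}

lemma IsWhitneyFunctionOn.isQuasiArc (h : I ≃ₜ Λ) (hs : 1 ≤ s) (hfin : μH[s] Λ ≠ ∞)
    {c : ℝ} (hc : 0 < c)
    (hlow : ∀ x y : Λ, c * diam (subarc h x y) ^ s ≤ (μH[s] (subarc h x y)).toReal)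
    (hf : IsWhitneyFunctionOn Λ (hausdorffFunction h s)) : IsQuasiArc s Λ := by
  obtain ⟨-, ⟨F, hF, -, hFf⟩, -⟩ := hf
  obtain ⟨L, hL⟩ := hF.locallyLipschitz.locallyLipschitzOn.exists_lipschitzOnWith_of_compact
    (isCompact_of_homeomorph_unitInterval h)
  refine ⟨hs, h, (L + 1) / c, by positivity, fun x y => ?_⟩
  rw [div_mul_eq_mul_div, le_div_iff₀' hc]
  calc c * diam (subarc h x y) ^ s ≤ (μH[s] (subarc h x y)).toReal := hlow x y
    _ = |F x - F y| := by
        rw [← abs_hausdorffFunction_sub h (one_pos.trans_le hs) hfin, hFf, hFf]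
    _ ≤ L * dist x y := hL.dist_le_mul x x.2 y y.2
    _ ≤ (L + 1) * dist x y := by gcongr; simp

lemma IsQuasiArc.diam_subarc_rpow_le {t : ℝ} (hΛ : IsQuasiArc t Λ) (hs : 0 ≤ s) (h : I ≃ₜ Λ) :
    ∃ C : ℝ, ∀ x y : Λ, diam (subarc h x y) ^ s ≤ C * dist x y ^ (s / t) := by
  obtain ⟨ht, h', C, hC, hquasi⟩ := hΛ
  have ht0 : 0 < t := one_pos.trans_le ht
  refine ⟨C ^ (s / t), fun x y => ?_⟩
  rw [subarc_eq_subarc h h', ← Real.mul_rpow hC.le dist_nonneg]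
  calc diam (subarc h' x y) ^ s = (diam (subarc h' x y) ^ t) ^ (s / t) := by
        rw [← Real.rpow_mul diam_nonneg, mul_div_cancel₀ _ ht0.ne']
    _ ≤ (C * dist x y) ^ (s / t) := by
        gcongr
        exact hquasi x y

lemma IsQuasiArc.isWhitneyFunctionOn_hausdorffFunction {t : ℝ} (hΛ : IsQuasiArc t Λ) (hts : t < s)
    (h : I ≃ₜ Λ) (hpos : μH[s] Λ ≠ 0) (hfin : μH[s] Λ ≠ ∞) {B : ℝ≥0}
    (hup : ∀ U ⊆ Λ, μH[s] U ≤ B * ediam U ^ s) :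
    IsWhitneyFunctionOn Λ (hausdorffFunction h s) := by
  have ht : 0 < t := one_pos.trans_le hΛ.1
  have hs : 0 < s := ht.trans hts
  obtain ⟨C, hdiam⟩ := hΛ.diam_subarc_rpow_le hs.le h
  have hholder : ∀ x y : Λ, |hausdorffFunction h s x - hausdorffFunction h s y| ≤
      B * C * dist x y ^ (s / t) := fun x y => by
    have htop : ediam (subarc h x y) ≠ ∞ := (isCompact_subarc h x y).isBounded.ediam_ne_top
    calc |hausdorffFunction h s x - hausdorffFunction h s y|
        = (μH[s] (subarc h x y)).toReal := abs_hausdorffFunction_sub h hs hfin x y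
      _ ≤ B * diam (subarc h x y) ^ s := by
        refine (ENNReal.toReal_mono (ENNReal.mul_ne_top ENNReal.coe_ne_top
          (ENNReal.rpow_ne_top_of_nonneg hs.le htop)) (hup _ (subarc_subset h x y))).trans_eq ?_
        rw [ENNReal.toReal_mul, ENNReal.coe_toReal, ← ENNReal.toReal_rpow, diam]
      _ ≤ B * (C * dist x y ^ (s / t)) := by
        gcongr
        exact hdiam x y
      _ = B * C * dist x y ^ (s / t) := by rw [mul_assoc]
  obtain ⟨F, hF, hFΛ⟩ := exists_contDiff_extension_of_rpow
    (isCompact_of_homeomorph_unitInterval h) ((one_lt_div ht).2 hts) hholder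
  refine ⟨isConnected_of_homeomorph_unitInterval h,
    ⟨F, hF, fun x hx => (hFΛ ⟨x, hx⟩).2, fun x => (hFΛ x).1⟩, h 0, h 1, fun heq => ?_⟩
  have habs := abs_hausdorffFunction_sub h hs hfin (h 0) (h 1)
  rw [heq, sub_self, abs_zero, subarc_zero_one] at habs
  exact (ENNReal.toReal_pos hpos hfin).ne habs

end WhitneyFunction

lemma affineSpan_triple_eq_top_of_im_ne_zero {a b c : ℂ} (h : ((c - a) / (b - a)).im ≠ 0) :
    affineSpan ℝ {a, b, c} = ⊤ := by
  have hcol : ¬ Collinear ℝ {a, b, c} := fun hcol => by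
    obtain ⟨v, hv⟩ := (collinear_iff_of_mem (mem_insert a _)).1 hcol
    obtain ⟨r, hr⟩ := hv b (by simp)
    obtain ⟨r', hr'⟩ := hv c (by simp)
    rcases eq_or_ne v 0 with rfl | hv0
    · simp [hr, hr'] at h
    · have hquot : (c - a) / (b - a) = ((r' / r : ℝ) : ℂ) := by
        simp [hr, hr', mul_div_mul_right _ _ hv0]
      exact h (by rw [hquot, Complex.ofReal_im])
  have htop := (affineIndependent_iff_not_collinear_set.2
    hcol).affineSpan_eq_top_iff_card_eq_finrank_add_one.2 (by simp [Complex.finrank_real_complex])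
  rwa [Matrix.range_cons, Matrix.range_cons_cons_empty, singleton_union] at htop

namespace PolygonData

variable {Ω : PolygonData}

lemma S_base_left (j : ℕ) : Ω.S j (Ω.A 0) = Ω.A (j - 1) := by simp [S]

lemma convex_preimage_S {D : Set ℂ} (hD : Convex ℝ D) (j : ℕ) : Convex ℝ (Ω.S j ⁻¹' D) := by
  have hconv := ((hD.translate_preimage_left (Ω.A (j - 1))).linear_preimage
    (LinearMap.mulLeft ℝ ((Ω.A j - Ω.A (j - 1)) / (Ω.A Ω.ℓ - Ω.A 0)))).translate_preimage_left
    (-Ω.A 0)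
  simp only [preimage_preimage, LinearMap.mulLeft_apply, ← sub_eq_add_neg] at hconv
  exact hconv

lemma closedTriangle_subset_convexHull :
    Ω.closedTriangle ⊆ convexHull ℝ {Ω.A 0, Ω.A Ω.ℓ, Ω.A Ω.q} :=
  closure_minimal interior_subset
    ((toFinite {Ω.A 0, Ω.A Ω.ℓ, Ω.A Ω.q}).isCompact_convexHull ℝ).isClosed

namespace IsBasicFigure

lemma base_ne_zero (hΩ : Ω.IsBasicFigure) : Ω.A Ω.ℓ - Ω.A 0 ≠ 0 := fun h => by
  simpa [h] using hΩ.apex_pos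

lemma S_base_right (hΩ : Ω.IsBasicFigure) (j : ℕ) : Ω.S j (Ω.A Ω.ℓ) = Ω.A j := by
  rw [S, div_mul_cancel₀ _ hΩ.base_ne_zero, sub_add_cancel]

lemma openTriangle_nonempty (hΩ : Ω.IsBasicFigure) : Ω.openTriangle.Nonempty :=
  interior_convexHull_nonempty_iff_affineSpan_eq_top.2
    (affineSpan_triple_eq_top_of_im_ne_zero hΩ.apex_pos.ne')

lemma vertex_mem_convexHull (hΩ : Ω.IsBasicFigure) {j : ℕ} (hj : j ≤ Ω.ℓ) :
    Ω.A j ∈ convexHull ℝ {Ω.A 0, Ω.A Ω.ℓ, Ω.A Ω.q} := by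
  rcases hΩ.vertex_mem j hj with (hapex | hbase) | hint
  · exact subset_convexHull ℝ _ (by simp [mem_singleton_iff.1 hapex])
  · exact segment_subset_convexHull (by simp) (by simp) hbase
  · exact interior_subset hint

lemma convexHull_subset_preimage_S (hΩ : Ω.IsBasicFigure) {j : ℕ} (hj : j ∈ Icc 1 Ω.ℓ) :
    convexHull ℝ {Ω.A 0, Ω.A Ω.ℓ, Ω.A Ω.q} ⊆
      Ω.S j ⁻¹' convexHull ℝ {Ω.A 0, Ω.A Ω.ℓ, Ω.A Ω.q} := by
  refine convexHull_min ?_ (convex_preimage_S (convex_convexHull ℝ _) j)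
  rintro z (rfl | rfl | rfl)
  · rw [mem_preimage, S_base_left]
    exact hΩ.vertex_mem_convexHull ((Nat.sub_le _ _).trans hj.2)
  · rw [mem_preimage, hΩ.S_base_right]
    exact hΩ.vertex_mem_convexHull hj.2
  · exact closedTriangle_subset_convexHull (hΩ.apex_mem j hj)

/-- The similitudes `S 1, …, S ℓ` of a basic figure as an iterated function system of
dilations of the plane. -/
noncomputable def similitude (hΩ : Ω.IsBasicFigure) (j : Icc 1 Ω.ℓ) : ℂ ≃ᵈ ℂ :=
  DilationEquiv.smulTorsor (Ω.S j 0) (norm_pos_iff.1 (hΩ.ratio_pos j j.2))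

lemma coe_similitude (hΩ : Ω.IsBasicFigure) (j : Icc 1 Ω.ℓ) : ⇑(hΩ.similitude j) = Ω.S j := by
  ext z
  simp only [similitude, DilationEquiv.smulTorsor_apply, smul_eq_mul, vadd_eq_add, S]
  ring

lemma ratio_similitude_lt_one (hΩ : Ω.IsBasicFigure) (j : Icc 1 Ω.ℓ) :
    Dilation.ratio (hΩ.similitude j) < 1 := by
  rw [similitude, DilationEquiv.smulTorsor_ratio (x := 0) (y := 1) _ (by simp)]
  exact hΩ.ratio_lt_one j j.2

lemma openSetCondition_similitude (hΩ : Ω.IsBasicFigure) :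
    OpenSetCondition hΩ.similitude Ω.openTriangle where
  isOpen := isOpen_interior
  nonempty := hΩ.openTriangle_nonempty
  image_subset j := by
    refine interior_maximal ?_ ((hΩ.similitude j).toHomeomorph.isOpenMap _ isOpen_interior)
    rw [hΩ.coe_similitude]
    exact image_subset_iff.2 (interior_subset.trans (hΩ.convexHull_subset_preimage_S j.2))
  disjoint i j hij := by
    simp only [hΩ.coe_similitude]
    exact hΩ.disjoint i i.2 j j.2 (Subtype.coe_injective.ne hij)

end IsBasicFigure

lemma IsSelfSimilarSet.eq_iUnion_similitude {Λ : Set ℂ} (hΛ : Ω.IsSelfSimilarSet Λ)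
    (hΩ : Ω.IsBasicFigure) : Λ = ⋃ j, hΩ.similitude j '' Λ := by
  simp only [hΩ.coe_similitude, ← biUnion_eq_iUnion (Icc 1 Ω.ℓ) fun j _ => Ω.S j '' Λ]
  exact hΛ.eq_iUnion

end PolygonData

theorem proposition6p6_general {ι : Type*} [Finite ι] {f : ι → ℂ ≃ᵈ ℂ}
    (hf : ∀ i, Dilation.ratio (f i) < 1) {V : Set ℂ} (hV : OpenSetCondition f V) {Λ : Set ℂ}
    (hΛ : Λ = ⋃ i, f i '' Λ) (h : I ≃ₜ Λ) {s : ℝ} (hs : s = (dimH Λ).toReal) :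
    (IsWhitneyFunctionOn Λ (hausdorffFunction h s) → IsQuasiArc s Λ) ∧
    ∀ t < s, IsQuasiArc t Λ → IsWhitneyFunctionOn Λ (hausdorffFunction h s) := by
  have hc := isCompact_of_homeomorph_unitInterval h
  have hconn := isConnected_of_homeomorph_unitInterval h
  obtain ⟨d, hd, hpos, hfin⟩ := hV.exists_dimH_eq hf hΛ hc hconn.nonempty
  have hd1 : 1 ≤ d := by
    have hle := one_le_dimH_of_isPreconnected hconn.isPreconnected
      (nontrivial_of_homeomorph_unitInterval h)
    rw [hd] at hle
    exact_mod_cast hle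
  obtain rfl : s = d := by rw [hs, hd, ENNReal.coe_toReal]
  obtain ⟨c, hc0, hlow⟩ :=
    exists_mul_diam_subarc_rpow_le h hf hΛ (mod_cast one_pos.trans_le hd1) hpos hfin
  obtain ⟨B, hup⟩ := hV.exists_hausdorffMeasure_le hf hΛ hc.isBounded d.2 hfin
  exact ⟨fun hw => hw.isQuasiArc h (mod_cast hd1) hfin hc0 hlow,
    fun t ht hq => hq.isWhitneyFunctionOn_hausdorffFunction ht h hpos hfin hup⟩

theorem proposition6p6 (Ω : PolygonData) (Λ : Set ℂ) (hΛ : Ω.IsRegularSelfSimilarArc Λ)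
    (h : unitInterval ≃ₜ Λ) (h0 : (h 0 : ℂ) ∈ Ω.S 1 '' Λ)
    (s : ℝ) (hs : s = (dimH Λ).toReal) :
    (IsWhitneyFunctionOn Λ (hausdorffFunction h s) → IsQuasiArc s Λ) ∧
    (∀ t : ℝ, 1 ≤ t → t < s → IsQuasiArc t Λ →
      IsWhitneyFunctionOn Λ (hausdorffFunction h s)) := by
  have hΩ := hΛ.isBasicFigure
  exact (proposition6p6_general hΩ.ratio_similitude_lt_one hΩ.openSetCondition_similitude
    (hΛ.isSelfSimilarSet.eq_iUnion_similitude hΩ) h hs).imp_right fun hw t _ => hw t
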